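/- For a topological space $X$, the weight of $X$ is the least cardinality of a base of $X$. A set $A\subseteq\mathbb{R}$ is called $\omega_1$-dense if $|U\cap A|=\omega_1$ for every nonempty open set $U\subseteq\mathbb{R}$. Let $\mathsf{BA}$ (Baumgartner's Axiom) be the statement that every two $\omega_1$-dense sets of reals are order isomorphic. Assume $\mathsf{BA}$. Let $K$ be a separable compact line of weight $\omega_1$, that is, a linearly ordered set which, with its order topology, is a compact separable space of weight $\omega_1$. Let $C(K)$ be the Banach space of real-valued continuous functions on $K$ with the supremum norm. Then $C(K)$ is isomorphic, as a Banach space (by a linear homeomorphism), to the direct sum $C(K)\oplus C(K)$. -/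

import Mathlib

open scoped Cardinal

/-- The weight of a topological space: the least cardinality of a base of its topology. -/
noncomputable def topologicalWeight (X : Type*) [TopologicalSpace X] : Cardinal :=
  sInf {c | ∃ B : Set (Set X), TopologicalSpace.IsTopologicalBasis B ∧ #B = c}

/-- The infimum in the definition of the weight is attained by some base. -/
theorem exists_basis_card_eq_topologicalWeight (X : Type*) [TopologicalSpace X] :
    ∃ B : Set (Set X), TopologicalSpace.IsTopologicalBasis B ∧ #B = topologicalWeight X :=
  csInf_mem (s := {c | ∃ B : Set (Set X), TopologicalSpace.IsTopologicalBasis B ∧ #B = c})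
    ⟨_, _, TopologicalSpace.isTopologicalBasis_opens, rfl⟩

/-- A subset `A` of a space `X` is `κ`-dense in `X` if it meets every nonempty open subset of `X`
in exactly `κ` points. -/
def IsCardinalDense {X : Type*} [TopologicalSpace X] (κ : Cardinal) (A : Set X) : Prop :=
  ∀ U : Set X, IsOpen U → U.Nonempty → #(U ∩ A : Set X) = κ

/-- Baumgartner's Axiom for `κ`: every two sets of reals that are `κ`-dense in `ℝ` are order
isomorphic (with the orders inherited from `ℝ`). -/
def BaumgartnerAxiom (κ : Cardinal) : Prop :=
  ∀ A B : Set ℝ, IsCardinalDense κ A → IsCardinalDense κ B → Nonempty (A ≃o B)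

open Filter Topology Set

/-! ### Null sequences in a normed space. -/

section

variable {X : Type*} [NormedAddCommGroup X]

/-! Call two points of `K` near when only countably many jumps lie between them. Separability makes
every class a closed interval containing countably many jumps. The endpoints of the classes, with
the outer ends of the two extreme classes left out, form a closed set `skeleton K`. Simultaneous
extension (`exists_extension_operator`) splits `C(K)` as `C(skeleton K) ⊕ Z`, where `Z` consists of
the functions vanishing on the skeleton.

The skeleton is the space of cuts of `classMins K`, and this order embeds in `ℝ` as an `ℵ₁`-dense
set (`exists_strictMono_classMins`). By Baumgartner's Axiom it may be replaced by any convenient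
`ℵ₁`-dense set `B`. On the other hand, only countably many jumps matter off the skeleton, so one
monotone map `K → [0,1]` separates all points there, and `Z` is complemented in `C[0,1]`
(`exists_ker_restrict_retract`).

Choose `B` disjoint from the Cantor set. Then the Cantor space is a retract of `Cuts B`, and
Milutin's lemma makes `C[0,1]`, hence `Z`, complemented in `C(Cuts B)`. By the axiom again, every
interval of `B` is a copy of `B`, so `C(Cuts B)` has a complemented copy of its own `c₀`-sum.
Pełczyński's decomposition method then shows that it absorbs its complemented subspaces, in
particular `Z` and itself. Hence `C(K) ≅ C(Cuts B) ⊕ Z ≅ C(Cuts B)`, a space isomorphic to its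
square. -/

theorem ZeroAtInftyContinuousMap.norm_apply_le_norm (f : ZeroAtInftyContinuousMap ℕ X) (n : ℕ) :
    ‖f n‖ ≤ ‖f‖ := by
  rw [← ZeroAtInftyContinuousMap.norm_toBCF_eq_norm]
  exact f.toBCF.norm_coe_le_norm n

theorem ZeroAtInftyContinuousMap.tendsto_atTop (f : ZeroAtInftyContinuousMap ℕ X) :
    Tendsto f atTop (𝓝 0) := by
  simpa [Nat.cofinite_eq_atTop] using f.zero_at_infty'

end

/-! ### Pełczyński's decomposition method. -/

section Absorption

variable {E X Z : Type*} [NormedAddCommGroup E] [NormedSpace ℝ E]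
  [NormedAddCommGroup X] [NormedSpace ℝ X] [NormedAddCommGroup Z] [NormedSpace ℝ Z]

/-- A uniformly bounded, pointwise null sequence of operators, as an operator into the space of
null sequences. -/
noncomputable def nullSequenceCLM (T : ℕ → E →L[ℝ] X) (C : ℝ) (hC : ∀ n, ‖T n‖ ≤ C)
    (h0 : ∀ e, Tendsto (fun n => T n e) atTop (𝓝 0)) :
    E →L[ℝ] ZeroAtInftyContinuousMap ℕ X :=
  LinearMap.mkContinuous
    { toFun := fun e => ⟨⟨fun n => T n e, continuous_of_discreteTopology⟩, by
        simpa [Nat.cofinite_eq_atTop] using h0 e⟩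
      map_add' := fun a b => by ext n; simp
      map_smul' := fun a b => by ext n; simp } C (fun e => by
        rw [← ZeroAtInftyContinuousMap.norm_toBCF_eq_norm]
        refine (BoundedContinuousFunction.norm_le
          (mul_nonneg ((norm_nonneg _).trans (hC 0)) (norm_nonneg _))).2 fun n => ?_
        exact (T n).le_of_opNorm_le (hC n) e)

@[simp] theorem nullSequenceCLM_apply (T : ℕ → E →L[ℝ] X) (C : ℝ) (hC : ∀ n, ‖T n‖ ≤ C)
    (h0 : ∀ e, Tendsto (fun n => T n e) atTop (𝓝 0)) (e : E) (n : ℕ) :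
    nullSequenceCLM T C hC h0 e n = T n e := rfl

/-- The evaluation of a null sequence at an index. -/
noncomputable def nullSequenceEval (n : ℕ) : ZeroAtInftyContinuousMap ℕ X →L[ℝ] X :=
  LinearMap.mkContinuous { toFun := fun f => f n, map_add' := fun _ _ => rfl,
                           map_smul' := fun _ _ => rfl } 1
    (fun f => by simpa using f.norm_apply_le_norm n)

@[simp] theorem nullSequenceEval_apply (n : ℕ) (f : ZeroAtInftyContinuousMap ℕ X) :
    nullSequenceEval n f = f n := rfl

theorem norm_nullSequenceEval_le (n : ℕ) :
    ‖(nullSequenceEval n : ZeroAtInftyContinuousMap ℕ X →L[ℝ] X)‖ ≤ 1 :=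
  LinearMap.mkContinuous_norm_le _ zero_le_one _

/-- The space of null sequences in `X` absorbs each complemented subspace of `X`. -/
theorem nonempty_nullSequence_equiv_prod (j : Z →L[ℝ] X) (r : X →L[ℝ] Z)
    (hr : ∀ z, r (j z) = z) :
    Nonempty (ZeroAtInftyContinuousMap ℕ X ≃L[ℝ] ZeroAtInftyContinuousMap ℕ X × Z) := by
  let F := ZeroAtInftyContinuousMap ℕ X
  let P : X →L[ℝ] X := j.comp r
  let ev : ℕ → F →L[ℝ] X := nullSequenceEval
  have hev : ∀ n, ‖ev n‖ ≤ 1 := norm_nullSequenceEval_le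
  have hP : ∀ T : F →L[ℝ] X, ‖T‖ ≤ 1 → ‖P.comp T‖ ≤ ‖P‖ := fun T hT =>
    (P.opNorm_comp_le T).trans (mul_le_of_le_one_right (norm_nonneg _) hT)
  have hlim : ∀ f : F, Tendsto (fun n => P (f n)) atTop (𝓝 0) := fun f => by
    have h := (P.continuous.tendsto 0).comp f.tendsto_atTop
    rwa [map_zero] at h
  -- Split `X` by the projection `P`. The complementary components stay in place and the
  -- `P`-components move one index down; the one pushed out at index `0` is recorded as `r (f 0)`.
  let A : F →L[ℝ] F := nullSequenceCLM (fun n => ev n - P.comp (ev n) + P.comp (ev (n + 1)))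
    (1 + ‖P‖ + ‖P‖)
    (fun n => (norm_add_le _ _).trans (add_le_add ((norm_sub_le _ _).trans
      (add_le_add (hev n) (hP _ (hev n)))) (hP _ (hev _))))
    (fun f => by
      have h := (f.tendsto_atTop.sub (hlim f)).add ((hlim f).comp (tendsto_add_atTop_nat 1))
      rw [sub_zero, add_zero] at h
      exact h)
  -- The inverse moves the `P`-components one index up and fills index `0` with `j z`.
  let s : ℕ → F × Z →L[ℝ] X := fun n => Nat.casesOn n
    (j.comp (ContinuousLinearMap.snd ℝ F Z))
    (fun m => (P.comp (ev m)).comp (ContinuousLinearMap.fst ℝ F Z))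
  have hs : ∀ n, ‖s n‖ ≤ ‖j‖ + ‖P‖ := by
    intro n
    rcases n with _ | m
    · exact ((j.opNorm_comp_le _).trans (mul_le_of_le_one_right (norm_nonneg _)
        (ContinuousLinearMap.norm_snd_le ..))).trans (by simp)
    · exact (((P.comp (ev m)).opNorm_comp_le _).trans (mul_le_of_le_one_right (norm_nonneg _)
        (ContinuousLinearMap.norm_fst_le ..))).trans ((hP _ (hev _)).trans (by simp))
  have hs0 : ∀ g, Tendsto (fun n => s n g) atTop (𝓝 0) := fun g =>
    (tendsto_add_atTop_iff_nat 1).1 (hlim g.1)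
  let fst := ContinuousLinearMap.fst ℝ F Z
  have hfst : ‖fst‖ ≤ 1 := ContinuousLinearMap.norm_fst_le ..
  have hfe : ∀ T : F →L[ℝ] X, ‖T.comp fst‖ ≤ ‖T‖ := fun T =>
    (T.opNorm_comp_le _).trans (mul_le_of_le_one_right (norm_nonneg _) hfst)
  let D : F × Z →L[ℝ] F := nullSequenceCLM
    (fun n => (ev n).comp fst - (P.comp (ev n)).comp fst + s n)
    (1 + ‖P‖ + (‖j‖ + ‖P‖))
    (fun n => (norm_add_le _ _).trans (add_le_add ((norm_sub_le _ _).trans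
      (add_le_add ((hfe _).trans (hev n)) ((hfe _).trans (hP _ (hev n))))) (hs n)))
    (fun g => by
      have h := (g.1.tendsto_atTop.sub (hlim g.1)).add (hs0 g)
      rw [sub_zero, add_zero] at h
      exact h)
  have hA : ∀ f n, A f n = f n - j (r (f n)) + j (r (f (n + 1))) := fun f n => rfl
  have hD0 : ∀ g, D g 0 = g.1 0 - j (r (g.1 0)) + j g.2 := fun g => rfl
  have hD1 : ∀ g n, D g (n + 1) = g.1 (n + 1) - j (r (g.1 (n + 1))) + j (r (g.1 n)) :=
    fun g n => rfl
  refine ⟨ContinuousLinearEquiv.equivOfInverse (A.prod (r.comp (ev 0))) D ?_ ?_⟩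
  · intro f
    ext n
    rcases n with _ | n
    · simp [hD0, hA, hr, ev]
    · simp [hD1, hA, hr]
  · intro g
    refine Prod.ext ?_ ?_
    · ext n
      rcases n with _ | n
      · simp [hD0, hA, hD1, hr]
      · simp [hD1, hA, hr]
    · simp [ev, hD0, hr]

/-- If `X` has a complemented copy of its space of null sequences, then `X` absorbs each of its
complemented subspaces. -/
theorem nonempty_equiv_prod_of_nullSequence_retract
    (I : ZeroAtInftyContinuousMap ℕ X →L[ℝ] X) (p : X →L[ℝ] ZeroAtInftyContinuousMap ℕ X)
    (hp : ∀ f, p (I f) = f) (j : Z →L[ℝ] X) (r : X →L[ℝ] Z) (hr : ∀ z, r (j z) = z) :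
    Nonempty (X ≃L[ℝ] X × Z) := by
  obtain ⟨e⟩ := nonempty_nullSequence_equiv_prod j r hr
  -- `X ≅ c₀(X) ⊕ V ≅ c₀(X) ⊕ Z ⊕ V ≅ X ⊕ Z`.
  let V := p.ker
  let a : X ≃L[ℝ] ZeroAtInftyContinuousMap ℕ X × V :=
    ContinuousLinearEquiv.equivOfRightInverse p I hp
  exact ⟨a.trans <| (e.prodCongr (.refl ℝ V)).trans <|
    (ContinuousLinearEquiv.prodAssoc ℝ _ _ _).trans <|
    ((ContinuousLinearEquiv.refl ℝ _).prodCongr (.prodComm ℝ Z V)).trans <|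
    (ContinuousLinearEquiv.prodAssoc ℝ _ _ _).symm.trans (a.symm.prodCongr (.refl ℝ Z))⟩

end Absorption

/-! ### Simultaneous extension from closed subsets of a compact line. -/

section Extension

variable {K : Type*} [LinearOrder K] [TopologicalSpace K] [OrderTopology K] [CompactSpace K]

theorem IsClosed.exists_isGreatest_inter_Iic {F : Set K} (hF : IsClosed F) {x : K}
    (h : (F ∩ Iic x).Nonempty) : ∃ a, IsGreatest (F ∩ Iic x) a :=
  (hF.inter isClosed_Iic).isCompact.exists_isGreatest h

theorem IsClosed.exists_isLeast_inter_Ici {F : Set K} (hF : IsClosed F) {x : K}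
    (h : (F ∩ Ici x).Nonempty) : ∃ a, IsLeast (F ∩ Ici x) a :=
  (hF.inter isClosed_Ici).isCompact.exists_isLeast h

/-- A function that is continuous on a closed set, continuous on its gaps, and bounded on each
interval by its bounds on the closed set is continuous from the left. -/
theorem continuousWithinAt_Icc_of_gaps {F : Set K} (hF : IsClosed F) {g : K → ℝ}
    (hgF : ContinuousOn g F)
    (hgap : ∀ a ∈ F, ∀ b ∈ F, a < b → (∀ z ∈ F, z ≤ a ∨ b ≤ z) → ContinuousOn g (Icc a b))
    (hbd : ∀ a ∈ F, ∀ b ∈ F, ∀ y, a ≤ y → y ≤ b → ∀ C r : ℝ,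
      (∀ z ∈ F, a ≤ z → z ≤ b → |g z - C| ≤ r) → |g y - C| ≤ r)
    {m M : K} (hm : m ∈ F) (hM : M ∈ F) {x : K} (hmx : m ≤ x) (hxM : x ≤ M) :
    ContinuousWithinAt g (Icc m x) x := by
  rcases hmx.eq_or_lt with rfl | hmx
  · rw [Icc_self]; exact continuousWithinAt_singleton
  -- If `F` does not accumulate at `x` from the left, then a left neighbourhood of `x` lies in the
  -- closure of a gap of `F`. Otherwise `x ∈ F`, and the bounds on intervals carry the continuity of
  -- `g` on `F` over to the points in between.
  by_cases h : ∃ c < x, ∀ z ∈ F, z ≤ c ∨ x ≤ z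
  · obtain ⟨c, hcx, hc⟩ := h
    obtain ⟨a, ⟨haF, hac⟩, ha⟩ := hF.exists_isGreatest_inter_Iic (x := c)
      ⟨m, hm, (hc m hm).resolve_right hmx.not_ge⟩
    obtain ⟨b, ⟨hbF, hxb⟩, hb⟩ := hF.exists_isLeast_inter_Ici (x := x) ⟨M, hM, hxM⟩
    have hax : a < x := lt_of_le_of_lt hac hcx
    have hcont := hgap a haF b hbF (hax.trans_le hxb) fun z hz =>
      (hc z hz).imp (fun h => ha ⟨hz, h⟩) (fun h => hb ⟨hz, h⟩)
    refine (hcont x ⟨hax.le, hxb⟩).mono_of_mem_nhdsWithin ?_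
    filter_upwards [self_mem_nhdsWithin, mem_nhdsWithin_of_mem_nhds (Ioi_mem_nhds hax)]
      with y hy hy'
    exact ⟨le_of_lt hy', hy.2.trans hxb⟩
  · push Not at h
    have hxF : x ∈ F := by
      rw [← hF.closure_eq, mem_closure_iff_nhds]
      intro U hU
      obtain ⟨l, hl, hlU⟩ := exists_Ioc_subset_of_mem_nhds hU ⟨m, hmx⟩
      obtain ⟨z, hz, hlz, hzx⟩ := h l hl
      exact ⟨z, hlU ⟨hlz, hzx.le⟩, hz⟩
    rw [Metric.continuousWithinAt_iff']
    intro ε hε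
    obtain ⟨U, hU, hUg⟩ := mem_nhdsWithin_iff_exists_mem_nhds_inter.1
      (Metric.continuousWithinAt_iff'.1 (hgF x hxF) (ε / 2) (half_pos hε))
    obtain ⟨l, hl, hlU⟩ := exists_Ioc_subset_of_mem_nhds hU ⟨m, hmx⟩
    obtain ⟨z, hz, hlz, hzx⟩ := h l hl
    filter_upwards [self_mem_nhdsWithin, mem_nhdsWithin_of_mem_nhds (Ioi_mem_nhds hzx)]
      with y hy hy'
    refine (hbd z hz x hxF y (le_of_lt hy') hy.2 (g x) (ε / 2) fun w hw hzw hwx => ?_).trans_lt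
      (half_lt_self hε)
    exact (hUg ⟨hlU ⟨hlz.trans_le hzw, hwx⟩, hw⟩).le

/-- Continuity from the right is continuity from the left in the order dual. -/
theorem continuousOn_Icc_of_gaps {F : Set K} (hF : IsClosed F) {g : K → ℝ}
    (hgF : ContinuousOn g F)
    (hgap : ∀ a ∈ F, ∀ b ∈ F, a < b → (∀ z ∈ F, z ≤ a ∨ b ≤ z) → ContinuousOn g (Icc a b))
    (hbd : ∀ a ∈ F, ∀ b ∈ F, ∀ y, a ≤ y → y ≤ b → ∀ C r : ℝ,
      (∀ z ∈ F, a ≤ z → z ≤ b → |g z - C| ≤ r) → |g y - C| ≤ r)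
    {m M : K} (hm : m ∈ F) (hM : M ∈ F) : ContinuousOn g (Icc m M) := by
  intro x hx
  have hl := continuousWithinAt_Icc_of_gaps hF hgF hgap hbd hm hM hx.1 hx.2
  have : CompactSpace Kᵒᵈ := ‹CompactSpace K›
  have hr := continuousWithinAt_Icc_of_gaps (K := Kᵒᵈ) (F := F) hF (g := g) hgF
    (fun a ha b hb hab h => by
      have := hgap b hb a ha hab fun z hz => (h z hz).symm
      exact this.mono fun z hz => ⟨hz.2, hz.1⟩)
    (fun a ha b hb y hay hyb C r h => hbd b hb a ha y hyb hay C r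
      fun z hz h1 h2 => h z hz h2 h1) hM hm hx.2 hx.1
  refine (hl.union hr).mono fun y hy => ?_
  rcases le_total y x with h | h
  · exact Or.inl ⟨hy.1, h⟩
  · exact Or.inr ⟨hy.2, h⟩

/-- Continuous functions on a closed subset of a compact line have simultaneous extensions. -/
theorem exists_extension_operator {F : Set K} (hF : IsClosed F) :
    ∃ E : C(F, ℝ) →L[ℝ] C(K, ℝ), ∀ f (x : F), E f x = f x := by
  rcases F.eq_empty_or_nonempty with rfl | hne
  · exact ⟨0, fun f x => x.2.elim⟩
  have : CompactSpace F := isCompact_iff_compactSpace.1 hF.isCompact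
  obtain ⟨m, hm, hmin⟩ := hF.isCompact.exists_isLeast hne
  obtain ⟨M, hM, hmax⟩ := hF.isCompact.exists_isGreatest hne
  have ha : ∀ x, ∃ a : F, m ≤ x → IsGreatest (F ∩ Iic x) a := fun x => by
    by_cases hx : m ≤ x
    · obtain ⟨a, ha⟩ := hF.exists_isGreatest_inter_Iic ⟨m, hm, hx⟩
      exact ⟨⟨a, ha.1.1⟩, fun _ => ha⟩
    · exact ⟨⟨m, hm⟩, fun h => (hx h).elim⟩
  have hb : ∀ x, ∃ b : F, x ≤ M → IsLeast (F ∩ Ici x) b := fun x => by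
    by_cases hx : x ≤ M
    · obtain ⟨a, ha⟩ := hF.exists_isLeast_inter_Ici ⟨M, hM, hx⟩
      exact ⟨⟨a, ha.1.1⟩, fun _ => ha⟩
    · exact ⟨⟨m, hm⟩, fun h => (hx h).elim⟩
  choose a ha using ha
  choose b hb using hb
  have hw : ∀ p q : K, ∃ w : C(K, ℝ), (p < q → w p = 0 ∧ w q = 1) ∧ ∀ x, w x ∈ Icc (0 : ℝ) 1 := by
    intro p q
    by_cases hpq : p < q
    · obtain ⟨w, h0, h1, h⟩ := exists_continuous_zero_one_of_isClosed (isClosed_singleton (x := p))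
        (isClosed_singleton (x := q)) (by simpa using hpq.ne)
      exact ⟨w, fun _ => ⟨h0 rfl, h1 rfl⟩, h⟩
    · exact ⟨0, fun h => (hpq h).elim, fun x => by simp⟩
  choose w hw hw01 using hw
  -- Interpolation across the gap `(a x, b x)` by a Urysohn function that does not depend on `f`,
  -- which makes `g` linear in `f`. On `F` both ends are `x`, so the value of `w` is immaterial
  -- there.
  let g : C(F, ℝ) → K → ℝ := fun f x =>
    (1 - w (a x) (b x) x) * f (a x) + w (a x) (b x) x * f (b x)
  have haF : ∀ x : F, a x = x := fun x =>
    Subtype.ext ((ha x (hmin x.2)).unique ⟨⟨x.2, le_rfl⟩, fun y hy => hy.2⟩)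
  have hbF : ∀ x : F, b x = x := fun x =>
    Subtype.ext ((hb x (hmax x.2)).unique ⟨⟨x.2, le_rfl⟩, fun y hy => hy.2⟩)
  have hgF : ∀ f (x : F), g f x = f x := fun f x => by
    simp only [g, haF, hbF]; ring
  have hconv : ∀ (f : C(F, ℝ)) (y : K) (C r : ℝ), |f (a y) - C| ≤ r → |f (b y) - C| ≤ r →
      |g f y - C| ≤ r := fun f y C r h1 h2 => by
    obtain ⟨h0, h01⟩ := hw01 (a y) (b y) y
    rw [abs_le] at *
    simp only [g]
    constructor <;> nlinarith
  have hcont : ∀ f, ContinuousOn (g f) (Icc m M) := by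
    intro f
    refine continuousOn_Icc_of_gaps hF ?_ ?_ ?_ hm hM
    · rw [continuousOn_iff_continuous_domRestrict]
      exact f.continuous.congr fun x => (hgF f x).symm
    · intro p hp q hq hpq hgap
      obtain ⟨hwp, hwq⟩ := hw p q hpq
      have : EqOn (g f) (fun x => (1 - w p q x) * f ⟨p, hp⟩ + w p q x * f ⟨q, hq⟩) (Icc p q) := by
        intro x hx
        rcases hx.1.eq_or_lt with rfl | hpx
        · rw [hgF f ⟨p, hp⟩]; simp [hwp]
        rcases hx.2.eq_or_lt with rfl | hxq
        · rw [hgF f ⟨x, hq⟩]; simp [hwq]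
        have h1 : a x = ⟨p, hp⟩ := Subtype.ext ((ha x ((hmin hp).trans hx.1)).unique
          ⟨⟨hp, hx.1⟩, fun z hz => (hgap z hz.1).resolve_right (hz.2.trans_lt hxq).not_ge⟩)
        have h2 : b x = ⟨q, hq⟩ := Subtype.ext ((hb x (hx.2.trans (hmax hq))).unique
          ⟨⟨hq, hx.2⟩, fun z hz => (hgap z hz.1).resolve_left (hpx.trans_le hz.2).not_ge⟩)
        simp only [g, h1, h2]
      refine ContinuousOn.congr ?_ this
      fun_prop
    · intro p hp q hq y hpy hyq C r h
      have h1 := ha y ((hmin hp).trans hpy)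
      have h2 := hb y (hyq.trans (hmax hq))
      refine hconv f y C r ?_ ?_
      · rw [← hgF]; exact h _ h1.1.1 (h1.2 ⟨hp, hpy⟩) (h1.1.2.trans hyq)
      · rw [← hgF]; exact h _ h2.1.1 (hpy.trans h2.1.2) (h2.2 ⟨hq, hyq⟩)
  -- Clamping to `[m, M]` extends by constants beyond the extreme points of `F`.
  let c : K → K := fun x => max m (min x M)
  have hc : ∀ x, c x ∈ Icc m M := fun x => ⟨le_max_left _ _, max_le (hmin hM) (min_le_right _ _)⟩
  have hcF : ∀ x : F, c x = x := fun x => by simp [c, hmin x.2, hmax x.2]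
  have hcc : Continuous c := by fun_prop
  refine ⟨LinearMap.mkContinuous (E := C(F, ℝ)) (F := C(K, ℝ)) (σ := RingHom.id ℝ)
    { toFun := fun f => ⟨fun x => g f (c x), (hcont f).comp_continuous hcc hc⟩
      map_add' := fun f f' => by ext x; simp [g]; ring
      map_smul' := fun r f => by ext x; simp [g]; ring } 1 fun f => ?_, fun f x => ?_⟩
  · rw [one_mul]
    refine (ContinuousMap.norm_le _ (norm_nonneg f)).2 fun x => ?_
    have := hconv f (c x) 0 ‖f‖ (by simpa using f.norm_coe_le_norm _)
      (by simpa using f.norm_coe_le_norm _)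
    simpa using this
  · exact (congrArg (g f) (hcF x)).trans (hgF f x)

end Extension

/-! ### Composition operators. -/

section Composition

variable {S T : Type*} [TopologicalSpace S] [TopologicalSpace T]

/-- Precomposition with a continuous map, as an operator between spaces of continuous functions. -/
def ContinuousMap.compRightCLM (h : C(S, T)) : C(T, ℝ) →L[ℝ] C(S, ℝ) where
  toFun f := f.comp h
  map_add' _ _ := rfl
  map_smul' _ _ := rfl
  cont := h.continuous_precomp

@[simp] theorem ContinuousMap.compRightCLM_apply (h : C(S, T)) (f : C(T, ℝ)) (x : S) :
    h.compRightCLM f x = f (h x) := rfl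

/-- Homeomorphic spaces have isomorphic spaces of continuous functions. -/
def Homeomorph.continuousMapCLE (h : S ≃ₜ T) : C(T, ℝ) ≃L[ℝ] C(S, ℝ) :=
  ContinuousLinearEquiv.equivOfInverse (ContinuousMap.compRightCLM (h : C(S, T)))
    (ContinuousMap.compRightCLM (h.symm : C(T, S)))
    (fun f => by ext x; simp) (fun f => by ext x; simp)

end Composition

/-! ### Milutin's averaging operator. -/

section Milutin

open unitInterval

namespace Milutin

/-- Prepending a digit to a binary sequence. -/
def cons (b : Bool) : C(ℕ → Bool, ℕ → Bool) where
  toFun e n := Nat.casesOn n b e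
  continuous_toFun := continuous_pi fun n => by cases n <;> fun_prop

@[simp] theorem cons_zero (b : Bool) (e : ℕ → Bool) : cons b e 0 = b := rfl

@[simp] theorem cons_succ (b : Bool) (e : ℕ → Bool) (n : ℕ) : cons b e (n + 1) = e n := rfl

/-- A weight on the unit interval that is `1` on `[0, 1/3]` and `0` on `[2/3, 1]`. -/
noncomputable def weight : C(I, ℝ) := ⟨fun t => max 0 (min 1 (2 - 3 * t)), by fun_prop⟩

/-- The inverses of the two affine maps of `[0, 1]` onto `[0, 2/3]` and onto `[1/3, 1]`. -/
noncomputable def rescale (b : Bool) : C(I, I) :=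
  ⟨fun t => projIcc 0 1 zero_le_one ((3 * t - b.toNat) / 2), by fun_prop⟩

/-- Averages over the `n`-th level of the binary tree. -/
noncomputable def average : ℕ → C(ℕ → Bool, ℝ) →L[ℝ] C(I, ℝ)
  | 0 => (ContinuousMap.const I (fun _ => false)).compRightCLM
  | n + 1 =>
    (ContinuousLinearMap.mul ℝ C(I, ℝ) weight).comp
      ((rescale false).compRightCLM.comp ((average n).comp (cons false).compRightCLM)) +
    (ContinuousLinearMap.mul ℝ C(I, ℝ) (1 - weight)).comp
      ((rescale true).compRightCLM.comp ((average n).comp (cons true).compRightCLM))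

theorem average_succ (n : ℕ) (f : C(ℕ → Bool, ℝ)) (t : I) :
    average (n + 1) f t = weight t * average n (f.comp (cons false)) (rescale false t) +
      (1 - weight t) * average n (f.comp (cons true)) (rescale true t) := rfl

theorem weight_mem (t : I) : 0 ≤ weight t ∧ weight t ≤ 1 :=
  ⟨le_max_left _ _, max_le zero_le_one (min_le_left _ _)⟩

/-- The weight vanishes for `t ≥ 2/3`, so the projection onto `[0, 1]` only acts where its result is
multiplied by `0`. -/
theorem rescale_false {t : I} (h : weight t ≠ 0) : (rescale false t : ℝ) = 3 * t / 2 := by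
  have h1 : (t : ℝ) < 2 / 3 := by
    by_contra! h1
    exact h (max_eq_left ((min_le_right _ _).trans (by linarith)))
  have := t.2.1
  simp only [rescale, ContinuousMap.coe_mk, coe_projIcc, Bool.toNat_false, Nat.cast_zero, sub_zero]
  rw [min_eq_right (by linarith), max_eq_right (by linarith)]

theorem rescale_true {t : I} (h : weight t ≠ 1) : (rescale true t : ℝ) = (3 * t - 1) / 2 := by
  have h1 : 1 / 3 < (t : ℝ) := by
    by_contra! h1
    refine h ?_
    change max 0 (min 1 (2 - 3 * (t : ℝ))) = 1
    rw [min_eq_left (by linarith), max_eq_right zero_le_one]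
  have := t.2.2
  simp only [rescale, ContinuousMap.coe_mk, coe_projIcc, Bool.toNat_true, Nat.cast_one]
  rw [min_eq_right (by linarith), max_eq_right (by linarith)]

theorem abs_convex_sub_le {w a b c r : ℝ} (h0 : 0 ≤ w) (h1 : w ≤ 1) (ha : w ≠ 0 → |a - c| ≤ r)
    (hb : w ≠ 1 → |b - c| ≤ r) : |w * a + (1 - w) * b - c| ≤ r := by
  rcases eq_or_ne w 0 with rfl | hw
  · simpa using hb (by simp)
  rcases eq_or_ne w 1 with rfl | hw'
  · simpa using ha (by simp)
  have ha := abs_le.1 (ha hw)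
  have hb := abs_le.1 (hb hw')
  rw [abs_le]
  constructor <;> nlinarith

/-- A continuous surjection of the Cantor space onto the unit interval, compatible with the two
affine maps of `[0, 1]` onto `[0, 2/3]` and onto `[1/3, 1]`. -/
theorem exists_coding : ∃ φ : C(ℕ → Bool, I),
    ∀ b e, (φ (cons b e) : ℝ) = (b.toNat + 2 * φ e) / 3 := by
  have hs : Summable fun n : ℕ => (1 / 3 : ℝ) * (2 / 3) ^ n :=
    (summable_geometric_of_lt_one (by norm_num) (by norm_num)).mul_left _
  -- The code of `e` is `∑ e n · (1/3)(2/3)^n`, of total mass `1`: removing the first digit scales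
  -- the tail by `2/3`.
  let F : (ℕ → Bool) → ℕ → ℝ := fun e n => (e n).toNat * ((1 / 3 : ℝ) * (2 / 3) ^ n)
  have hF0 : ∀ e n, 0 ≤ F e n := fun e n => by positivity
  have hF : ∀ e n, F e n ≤ (1 / 3 : ℝ) * (2 / 3) ^ n := fun e n =>
    mul_le_of_le_one_left (by positivity) (by exact_mod_cast Bool.toNat_le _)
  have hsF : ∀ e, Summable (F e) := fun e => hs.of_nonneg_of_le (hF0 e) (hF e)
  have hc : Continuous fun e => ∑' n, F e n := by
    refine continuous_tsum (fun n => ?_) hs fun n e => ?_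
    · exact ((continuous_of_discreteTopology (f := fun b : Bool => (b.toNat : ℝ))).comp
        (continuous_apply n)).mul continuous_const
    · rw [Real.norm_of_nonneg (hF0 e n)]; exact hF e n
  refine ⟨⟨fun e => ⟨∑' n, F e n, tsum_nonneg (hF0 e), ?_⟩, hc.subtype_mk _⟩, fun b e => ?_⟩
  · refine ((hsF e).tsum_le_tsum (hF e) hs).trans_eq ?_
    rw [tsum_mul_left, tsum_geometric_of_lt_one (by norm_num) (by norm_num)]
    norm_num
  · change ∑' n, F (cons b e) n = (b.toNat + 2 * ∑' n, F e n) / 3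
    rw [(hsF _).tsum_eq_zero_add]
    have : ∀ n, F (cons b e) (n + 1) = 2 / 3 * F e n := fun n => by
      simp only [F, cons_succ]; ring
    simp only [this, tsum_mul_left]
    simp only [F, cons_zero]
    ring

/-- The average at `t` is a convex combination of values of `f` at points coded within `(2/3)^n` of
`t`: each level contracts distances by `2/3`, and at level `0` all distances are at most `1`. -/
theorem abs_average_sub_le {φ : C(ℕ → Bool, I)}
    (hφ : ∀ b e, (φ (cons b e) : ℝ) = (b.toNat + 2 * φ e) / 3) (n : ℕ) :
    ∀ (f : C(ℕ → Bool, ℝ)) (t : I) (c r : ℝ),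
      (∀ e, |(φ e : ℝ) - t| ≤ (2 / 3) ^ n → |f e - c| ≤ r) → |average n f t - c| ≤ r := by
  induction n with
  | zero =>
    intro f t c r h
    refine h (fun _ => false) ?_
    have h1 := (φ fun _ => false).2
    have h2 := t.2
    rw [pow_zero, abs_le]
    constructor <;> linarith [h1.1, h1.2, h2.1, h2.2]
  | succ n ih =>
    intro f t c r h
    rw [average_succ]
    refine abs_convex_sub_le (weight_mem t).1 (weight_mem t).2 (fun hw => ?_) fun hw => ?_
    · refine ih _ _ _ _ fun e he => h _ ?_
      rw [rescale_false hw] at he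
      rw [hφ, pow_succ, Bool.toNat_false, Nat.cast_zero]
      rw [abs_le] at *
      constructor <;> linarith
    · refine ih _ _ _ _ fun e he => h _ ?_
      rw [rescale_true hw] at he
      rw [hφ, pow_succ, Bool.toNat_true, Nat.cast_one]
      rw [abs_le] at *
      constructor <;> linarith

/-- The two averages share their first `n` levels of weights; below these they sample `f` in the
same cylinders, where it oscillates by at most `r`. This gives the Cauchy property. -/
theorem abs_average_sub_average_le (n : ℕ) : ∀ (f : C(ℕ → Bool, ℝ)) (r : ℝ),
    (∀ d e, (∀ i < n, d i = e i) → |f d - f e| ≤ r) → ∀ m ≥ n, ∀ t,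
      |average m f t - average n f t| ≤ r := by
  obtain ⟨φ, hφ⟩ := exists_coding
  induction n with
  | zero =>
    intro f r h m _ t
    exact abs_average_sub_le hφ m f t _ r fun e _ => h _ _ (by simp)
  | succ n ih =>
    intro f r h m hm t
    obtain ⟨m, rfl⟩ : ∃ k, m = k + 1 := ⟨m - 1, by omega⟩
    have key : ∀ b, |average m (f.comp (cons b)) (rescale b t) -
        average n (f.comp (cons b)) (rescale b t)| ≤ r := fun b =>
      ih _ r (fun d e hde => h (cons b d) (cons b e) fun i hi => by
        rcases i with _ | i
        · rfl
        · exact hde i (by omega)) m (by omega) _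
    have := abs_convex_sub_le (c := 0) (weight_mem t).1 (weight_mem t).2
      (fun _ => by simpa using key false) (fun _ => by simpa using key true)
    rw [average_succ, average_succ]
    refine le_of_eq_of_le (congrArg _ ?_) this
    ring

theorem exists_oscillation_le (f : C(ℕ → Bool, ℝ)) {r : ℝ} (hr : 0 < r) :
    ∃ n, ∀ d e, (∀ i < n, d i = e i) → |f d - f e| ≤ r := by
  let _ : MetricSpace (ℕ → Bool) := PiNat.metricSpace
  obtain ⟨δ, hδ, h⟩ := Metric.uniformContinuous_iff.1
    (@CompactSpace.uniformContinuous_of_continuous (ℕ → Bool) ℝ PseudoMetricSpace.toUniformSpace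
      _ _ f f.continuous) r hr
  obtain ⟨n, hn⟩ := exists_pow_lt_of_lt_one hδ (by norm_num : (1 / 2 : ℝ) < 1)
  refine ⟨n, fun d e hde => (h ?_).le⟩
  refine lt_of_le_of_lt ?_ hn
  rw [dist_comm]
  exact PiNat.mem_cylinder_iff_dist_le.1 fun i hi => (hde i hi).symm

/-- Milutin's lemma: there is a continuous map of the Cantor space to the unit interval that admits
an averaging operator. -/
theorem exists_averaging_operator : ∃ (φ : C(ℕ → Bool, I)) (R : C(ℕ → Bool, ℝ) →L[ℝ] C(I, ℝ)),
    ∀ h : C(I, ℝ), R (h.comp φ) = h := by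
  obtain ⟨φ, hφ⟩ := exists_coding
  have hlim : ∀ f, ∃ g, Tendsto (fun n => average n f) atTop (𝓝 g) := by
    intro f
    refine cauchySeq_tendsto_of_complete (Metric.cauchySeq_iff'.2 fun ε hε => ?_)
    obtain ⟨n, hn⟩ := exists_oscillation_le f (half_pos hε)
    refine ⟨n, fun m hm => lt_of_le_of_lt ?_ (half_lt_self hε)⟩
    exact (ContinuousMap.dist_le (half_pos hε).le).2
      (abs_average_sub_average_le n f _ hn m hm)
  choose g hg using hlim
  -- Banach–Steinhaus makes the limit operator continuous. For `h ∘ φ`, the average at `t` only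
  -- involves values of `h` within `(2/3)^m` of `t`, so the limit is `h`.
  refine ⟨φ, continuousLinearMapOfTendsto average (f := g) (tendsto_pi_nhds.2 hg), fun h => ?_⟩
  refine tendsto_nhds_unique (hg _) (Metric.tendsto_atTop.2 fun ε hε => ?_)
  obtain ⟨δ, hδ, hh⟩ := Metric.uniformContinuous_iff.1
    (CompactSpace.uniformContinuous_of_continuous h.continuous) (ε / 2) (half_pos hε)
  obtain ⟨n, hn⟩ := exists_pow_lt_of_lt_one hδ (by norm_num : (2 / 3 : ℝ) < 1)
  refine ⟨n, fun m hm => lt_of_le_of_lt ?_ (half_lt_self hε)⟩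
  refine (ContinuousMap.dist_le (half_pos hε).le).2 fun t => ?_
  refine abs_average_sub_le hφ m _ t _ _ fun e he => (hh ?_).le
  refine lt_of_le_of_lt he (lt_of_le_of_lt ?_ hn)
  exact pow_le_pow_of_le_one (by norm_num) (by norm_num) hm

end Milutin

end Milutin

/-! ### The space of cuts of a linear order, and its `c₀`-sum. -/

section Cuts

/-- The initial segments of a linear order, as antitone `0-1` sequences with the topology of
pointwise convergence. -/
abbrev Cuts (B : Type*) [LinearOrder B] := {s : B → Bool // Antitone s}

variable {B : Type*} [LinearOrder B]

theorem antitone_bool_iff {s : B → Bool} :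
    Antitone s ↔ ∀ x y, x ≤ y → s y = true → s x = true := by
  simp only [Antitone, Bool.le_iff_imp]

instance Cuts.instCompactSpace : CompactSpace (Cuts B) := by
  refine isCompact_iff_compactSpace.1 (IsClosed.isCompact ?_)
  have : {s : B → Bool | Antitone s} = ⋂ x, ⋂ y, ⋂ _ : x ≤ y, {s | s y ≤ s x} := by
    ext s; simp [Antitone]
  change IsClosed {s : B → Bool | Antitone s}
  rw [this]
  refine isClosed_iInter fun x => isClosed_iInter fun y => isClosed_iInter fun _ => ?_
  exact (isClosed_discrete {p : Bool × Bool | p.1 ≤ p.2}).preimage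
    (f := fun s : B → Bool => (s y, s x)) (by fun_prop)

theorem Cuts.continuous_eval (x : B) : Continuous fun s : Cuts B => s.1 x :=
  (continuous_apply x).comp continuous_subtype_val

theorem Cuts.isClopen_eval (x : B) (c : Bool) : IsClopen {s : Cuts B | s.1 x = c} :=
  (isClopen_discrete {c}).preimage (Cuts.continuous_eval x)

/-- Isomorphic linear orders have homeomorphic spaces of cuts. -/
def Cuts.homeomorph {B' : Type*} [LinearOrder B'] (e : B ≃o B') : Cuts B ≃ₜ Cuts B' where
  toFun s := ⟨fun x => s.1 (e.symm x), fun _ _ h => s.2 (e.symm.monotone h)⟩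
  invFun s := ⟨fun x => s.1 (e x), fun _ _ h => s.2 (e.monotone h)⟩
  left_inv s := by ext; simp
  right_inv s := by ext; simp
  continuous_toFun := (continuous_pi fun _ => Cuts.continuous_eval _).subtype_mk _
  continuous_invFun := (continuous_pi fun _ => Cuts.continuous_eval _).subtype_mk _

/-- The trace of a cut on a suborder isomorphic to the whole order. -/
def Cuts.restrict {C : Set B} (e : B ≃o C) : C(Cuts B, Cuts B) where
  toFun s := ⟨fun x => s.1 (e x), fun _ _ h => s.2 (e.monotone h)⟩
  continuous_toFun := (continuous_pi fun _ => Cuts.continuous_eval _).subtype_mk _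

/-- The cuts through an open interval isomorphic to the whole order. -/
def Cuts.insert {a c : B} (e : B ≃o Ioo a c) : C(Cuts B, Cuts B) where
  toFun s := ⟨fun y => if h : y ∈ Ioo a c then s.1 (e.symm ⟨y, h⟩) else decide (y ≤ a), by
    rw [antitone_bool_iff]
    intro x y hxy hy
    split_ifs at hy with h
    · split_ifs with h'
      · exact antitone_bool_iff.1 s.2 _ _ (e.symm.monotone hxy) hy
      · simpa using not_lt.1 fun hax => h' ⟨hax, hxy.trans_lt h.2⟩
    · have hya : y ≤ a := by simpa using hy
      rw [dif_neg fun h' => (hxy.trans hya).not_gt h'.1]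
      simpa using hxy.trans hya⟩
  continuous_toFun := by
    refine (continuous_pi fun y => ?_).subtype_mk _
    split_ifs
    · exact Cuts.continuous_eval _
    · exact continuous_const

theorem Cuts.insert_left {a c : B} (e : B ≃o Ioo a c) (s : Cuts B) :
    (Cuts.insert e s).1 a = true := by
  simp [Cuts.insert]

theorem Cuts.insert_of_le {a c x : B} (e : B ≃o Ioo a c) (s : Cuts B) (hx : x ≤ a) :
    (Cuts.insert e s).1 x = true := by
  simp [Cuts.insert, hx.not_gt, hx]

theorem Cuts.insert_of_ge {a c x : B} (hac : a < c) (e : B ≃o Ioo a c) (s : Cuts B) (hx : c ≤ x) :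
    (Cuts.insert e s).1 x = false := by
  simp [Cuts.insert, hx.not_gt, hac.trans_le hx]

theorem Cuts.restrict_insert {a c : B} (e : B ≃o Ioo a c) (s : Cuts B) :
    Cuts.restrict e (Cuts.insert e s) = s := by
  ext x
  change (if h : (e x : B) ∈ Ioo a c then s.1 (e.symm ⟨e x, h⟩) else _) = s.1 x
  rw [dif_pos (e x).2]
  simp

theorem ContinuousMap.norm_compRightCLM_le {S T : Type*} [TopologicalSpace S] [TopologicalSpace T]
    [CompactSpace S] [CompactSpace T] (h : C(S, T)) : ‖h.compRightCLM‖ ≤ 1 :=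
  ContinuousLinearMap.opNorm_le_bound _ zero_le_one fun f => by
    rw [one_mul]
    exact (ContinuousMap.norm_le _ (norm_nonneg f)).2 fun x => f.norm_coe_le_norm _

namespace Cuts

variable {b : ℕ → B} (τ : ∀ n, B ≃o Ioo (b n) (b (n + 1)))

variable (b) in
/-- The clopen set of the cuts between two consecutive terms of a sequence. -/
def block (n : ℕ) : Set (Cuts B) := {s | s.1 (b n) = true} ∩ {s | s.1 (b (n + 1)) = false}

theorem isClopen_block (n : ℕ) : IsClopen (block b n) :=
  (isClopen_eval _ _).inter (isClopen_eval _ _)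

theorem eq_of_mem_block (hb : Monotone b) {s : Cuts B} {m n : ℕ} (hm : s ∈ block b m)
    (hn : s ∈ block b n) : m = n := by
  by_contra h
  wlog hmn : m < n generalizing m n
  · exact this hn hm (Ne.symm h) (lt_of_le_of_ne (not_lt.1 hmn) (Ne.symm h))
  have := antitone_bool_iff.1 s.2 _ _ (hb hmn) hn.1
  rw [hm.2] at this
  exact Bool.noConfusion this

/-- The values of a sequence of functions, glued along the blocks. -/
noncomputable def glueTerm (f : ℕ → C(Cuts B, ℝ)) (n : ℕ) (s : Cuts B) : ℝ :=
  (block b n).indicator (fun s => f n (restrict (τ n) s)) s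

theorem continuous_glueTerm (f : ℕ → C(Cuts B, ℝ)) (n : ℕ) : Continuous (glueTerm τ f n) :=
  ((f n).continuous.comp (restrict (τ n)).continuous).indicator
    (by simp [(isClopen_block n).frontier_eq])

theorem glueTerm_of_mem (f : ℕ → C(Cuts B, ℝ)) {n : ℕ} {s : Cuts B} (hs : s ∈ block b n) :
    glueTerm τ f n s = f n (restrict (τ n) s) :=
  indicator_of_mem hs _

theorem glueTerm_of_notMem (f : ℕ → C(Cuts B, ℝ)) {n : ℕ} {s : Cuts B} (hs : s ∉ block b n) :
    glueTerm τ f n s = 0 :=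
  indicator_of_notMem hs _

theorem tsum_glueTerm_of_mem (hb : Monotone b) (f : ℕ → C(Cuts B, ℝ)) {n : ℕ} {s : Cuts B}
    (hs : s ∈ block b n) : ∑' m, glueTerm τ f m s = f n (restrict (τ n) s) := by
  rw [tsum_eq_single n fun m hm => glueTerm_of_notMem τ f
    fun h => hm (eq_of_mem_block hb h hs), glueTerm_of_mem τ f hs]

theorem tsum_glueTerm_of_notMem (f : ℕ → C(Cuts B, ℝ)) {s : Cuts B}
    (hs : ∀ n, s ∉ block b n) : ∑' m, glueTerm τ f m s = 0 := by
  have : ∀ m, glueTerm τ f m s = 0 := fun m => glueTerm_of_notMem τ f (hs m)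
  simp [this]

/-- The blocks are clopen and disjoint and `‖f n‖ → 0`, so the partial sums are continuous and
converge uniformly. -/
theorem continuous_tsum_glueTerm (hb : Monotone b)
    (f : ZeroAtInftyContinuousMap ℕ C(Cuts B, ℝ)) :
    Continuous fun s => ∑' m, glueTerm τ f m s := by
  refine continuous_of_uniform_approx_of_continuous fun u hu => ?_
  obtain ⟨ε, hε, hu⟩ := Metric.mem_uniformity_dist.1 hu
  obtain ⟨N, hN⟩ := Metric.tendsto_atTop.1 f.tendsto_atTop ε hε
  refine ⟨fun s => ∑ m ∈ Finset.range N, glueTerm τ f m s,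
    continuous_finsetSum _ fun m _ => continuous_glueTerm τ f m, fun s => hu ?_⟩
  beta_reduce
  by_cases h : ∃ n, s ∈ block b n
  · obtain ⟨n, hn⟩ := h
    by_cases hnN : n < N
    · rw [tsum_eq_sum (s := Finset.range N) fun m hm => glueTerm_of_notMem τ f
        fun h => hm (by rwa [eq_of_mem_block hb h hn, Finset.mem_range])]
      simpa using hε
    · rw [tsum_glueTerm_of_mem τ hb f hn, Finset.sum_eq_zero fun m hm => glueTerm_of_notMem τ f
        fun h => hnN (by rwa [← eq_of_mem_block hb h hn, ← Finset.mem_range])]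
      rw [Real.dist_eq, sub_zero]
      have := hN n (not_lt.1 hnN)
      rw [dist_zero_right] at this
      exact ((f n).norm_coe_le_norm _).trans_lt this
  · rw [tsum_glueTerm_of_notMem τ f (by simpa using h),
      Finset.sum_eq_zero fun m hm => glueTerm_of_notMem τ f fun h' => h ⟨m, h'⟩]
    simpa using hε

theorem abs_tsum_glueTerm_le (hb : Monotone b) (f : ZeroAtInftyContinuousMap ℕ C(Cuts B, ℝ))
    (s : Cuts B) : |∑' m, glueTerm τ f m s| ≤ ‖f‖ := by
  by_cases h : ∃ n, s ∈ block b n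
  · obtain ⟨n, hn⟩ := h
    rw [tsum_glueTerm_of_mem τ hb f hn]
    exact ((f n).norm_coe_le_norm _).trans (f.norm_apply_le_norm n)
  · rw [tsum_glueTerm_of_notMem τ f (by simpa using h), abs_zero]
    exact norm_nonneg f

theorem summable_glueTerm (hb : Monotone b) (f : ℕ → C(Cuts B, ℝ)) (s : Cuts B) :
    Summable fun n => glueTerm τ f n s := by
  refine summable_of_hasFiniteSupport (Set.Subsingleton.finite fun m hm n hn => ?_)
  exact eq_of_mem_block hb (mem_of_indicator_ne_zero hm) (mem_of_indicator_ne_zero hn)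

variable (b) in
open Classical in
/-- The cut above all the terms of a sequence. -/
noncomputable def sup : Cuts B :=
  ⟨fun x => decide (∃ n, x ≤ b n), by
    rw [antitone_bool_iff]
    intro x y hxy hy
    simp only [decide_eq_true_eq] at *
    exact hy.imp fun n hn => hxy.trans hn⟩

theorem sup_apply (n : ℕ) : (sup b).1 (b n) = true := by
  simpa [sup] using ⟨n, le_rfl⟩

/-- At a fixed `x` the inserted cut is eventually constant: `true` once `x ≤ b n`, and always
`false` if `x` is above the sequence. The filter `⊤` makes this uniform in the inserted cut, as
convergence in the supremum norm requires. -/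
theorem tendsto_insert (hb : StrictMono b) :
    Tendsto (fun q : ℕ × Cuts B => insert (τ q.1) q.2) (atTop ×ˢ ⊤) (𝓝 (sup b)) := by
  rw [tendsto_subtype_rng, tendsto_pi_nhds]
  intro x
  refine tendsto_nhds_of_eventually_eq ?_
  by_cases hx : ∃ n, x ≤ b n
  · obtain ⟨n, hn⟩ := hx
    filter_upwards [(eventually_ge_atTop n).prod_inl ⊤] with q hq
    rw [insert_of_le _ _ (hn.trans (hb.monotone hq))]
    simpa [sup] using ⟨n, hn⟩
  · refine Eventually.of_forall fun q => ?_
    rw [insert_of_ge (hb (Nat.lt_succ_self _)) _ _ (not_le.1 fun h => hx ⟨_, h⟩).le]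
    simpa [sup] using hx

/-- If every interval between consecutive terms of an increasing sequence is isomorphic to the whole
order, then the space of null sequences in `C(Cuts B)` is complemented in `C(Cuts B)`. -/
theorem exists_nullSequence_retract (hb : StrictMono b) (τ : ∀ n, B ≃o Ioo (b n) (b (n + 1))) :
    ∃ (I : ZeroAtInftyContinuousMap ℕ C(Cuts B, ℝ) →L[ℝ] C(Cuts B, ℝ))
      (p : C(Cuts B, ℝ) →L[ℝ] ZeroAtInftyContinuousMap ℕ C(Cuts B, ℝ)), ∀ f, p (I f) = f := by
  let I : ZeroAtInftyContinuousMap ℕ C(Cuts B, ℝ) →L[ℝ] C(Cuts B, ℝ) := LinearMap.mkContinuous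
    (E := ZeroAtInftyContinuousMap ℕ C(Cuts B, ℝ)) (F := C(Cuts B, ℝ)) (σ := RingHom.id ℝ)
    { toFun := fun f => ⟨fun s => ∑' m, glueTerm τ f m s,
        continuous_tsum_glueTerm τ hb.monotone f⟩
      map_add' := fun f g => by
        ext s
        simp only [ContinuousMap.coe_mk, ContinuousMap.add_apply]
        rw [← (summable_glueTerm τ hb.monotone f s).tsum_add
          (summable_glueTerm τ hb.monotone g s)]
        refine tsum_congr fun n => ?_
        by_cases h : s ∈ block b n <;> simp [glueTerm, h]
      map_smul' := fun c f => by
        ext s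
        simp only [ContinuousMap.coe_mk, ContinuousMap.smul_apply, smul_eq_mul, RingHom.id_apply]
        rw [← tsum_mul_left]
        refine tsum_congr fun n => ?_
        by_cases h : s ∈ block b n <;> simp [glueTerm, h] } 1 fun f => by
      rw [one_mul]
      exact (ContinuousMap.norm_le _ (norm_nonneg f)).2 (abs_tsum_glueTerm_le τ hb.monotone f)
  -- The restrictions to the copies tend uniformly to the constant `f (sup b)`; subtracting it gives
  -- a null sequence. Glued functions vanish at `sup b`, which lies in no block, so they are
  -- unaffected.
  let p : C(Cuts B, ℝ) →L[ℝ] ZeroAtInftyContinuousMap ℕ C(Cuts B, ℝ) := nullSequenceCLM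
    (fun n => (insert (τ n)).compRightCLM -
      (ContinuousMap.const (Cuts B) (sup b)).compRightCLM) (1 + 1)
    (fun n => (norm_sub_le _ _).trans (add_le_add (ContinuousMap.norm_compRightCLM_le _)
      (ContinuousMap.norm_compRightCLM_le _)))
    (fun f => by
      have h := (f.continuous.tendsto (sup b)).comp (tendsto_insert τ hb)
      rw [Metric.tendsto_atTop]
      intro ε hε
      have h' := h.eventually (Metric.ball_mem_nhds _ (half_pos hε))
      rw [← principal_univ, eventually_prod_principal_iff] at h'
      obtain ⟨N, hN⟩ := eventually_atTop.1 h'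
      refine ⟨N, fun n hn => lt_of_le_of_lt ?_ (half_lt_self hε)⟩
      rw [dist_zero_right]
      exact (ContinuousMap.norm_le _ (half_pos hε).le).2 fun s => (hN n hn s trivial).le)
  refine ⟨I, p, fun f => ?_⟩
  ext n s
  change ∑' m, glueTerm τ f m (insert (τ n) s) - ∑' m, glueTerm τ f m (sup b) = f n s
  rw [tsum_glueTerm_of_mem τ hb.monotone f (n := n)
    ⟨insert_left _ _, insert_of_ge (hb (Nat.lt_succ_self n)) _ _ le_rfl⟩,
    restrict_insert, tsum_glueTerm_of_notMem τ f, sub_zero]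
  intro m hm
  have := sup_apply (b := b) (m + 1)
  rw [hm.2] at this
  exact Bool.noConfusion this

end Cuts

end Cuts

/-! ### The Cantor space as a retract of a space of cuts. -/

section CantorRetract

/-- The point of the Cantor set with given ternary digits. -/
noncomputable def cantorPoint (e : ℕ → Bool) : ℝ := cantorSetHomeomorphNatToBool.symm e

theorem cantorPoint_mem (e : ℕ → Bool) : cantorPoint e ∈ cantorSet :=
  (cantorSetHomeomorphNatToBool.symm e).2

theorem continuous_cantorPoint : Continuous cantorPoint :=
  continuous_subtype_val.comp cantorSetHomeomorphNatToBool.symm.continuous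

theorem cantorPoint_eq (e : ℕ → Bool) :
    cantorPoint e = (2 * (e 0).toNat + cantorPoint fun n => e (n + 1)) / 3 := by
  have h : ∀ e, cantorPoint e = Real.ofDigits (fun i => cond (e i) (2 : Fin 3) 0) := fun e => rfl
  rw [h, h, Real.ofDigits_eq_sum_add_ofDigits _ 1]
  rcases he : e 0 <;> simp [Real.ofDigitsTerm, he] <;> ring

theorem cantorPoint_mem_Icc (e : ℕ → Bool) : cantorPoint e ∈ Icc (0 : ℝ) 1 :=
  cantorSet_subset_unitInterval (cantorPoint_mem e)

/-- The points of the Cantor set with given first digits are separated by their next digit. -/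
theorem exists_cantorPoint_gap (n : ℕ) : ∀ d : ℕ → Bool, ∃ p q : ℝ, p < q ∧
    ∀ e : ℕ → Bool, (∀ i < n, e i = d i) →
      (e n = false → cantorPoint e ≤ p) ∧ (e n = true → q ≤ cantorPoint e) := by
  induction n with
  | zero =>
    intro d
    refine ⟨1 / 3, 2 / 3, by norm_num, fun e _ => ⟨fun h => ?_, fun h => ?_⟩⟩
    all_goals
      have := cantorPoint_mem_Icc fun n => e (n + 1)
      rw [cantorPoint_eq, h]
      simp only [Bool.toNat_false, Bool.toNat_true, Nat.cast_zero, Nat.cast_one]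
      linarith [this.1, this.2]
  | succ n ih =>
    intro d
    obtain ⟨p, q, hpq, h⟩ := ih fun i => d (i + 1)
    refine ⟨(2 * (d 0).toNat + p) / 3, (2 * (d 0).toNat + q) / 3, by linarith, fun e he => ?_⟩
    obtain ⟨h1, h2⟩ := h (fun i => e (i + 1)) fun i hi => he (i + 1) (by omega)
    rw [cantorPoint_eq e, he 0 (by omega)]
    exact ⟨fun h => by linarith [h1 h], fun h => by linarith [h2 h]⟩

/-- The set is a union of two copies of itself scaled by `1/3`, so its finite measure is at most
`2/3` of itself. -/
theorem volume_cantorSet : MeasureTheory.volume cantorSet = 0 := by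
  have hfin : MeasureTheory.volume cantorSet ≠ ⊤ := isCompact_cantorSet.measure_ne_top
  have h1 : MeasureTheory.volume ((· / 3) '' cantorSet) =
      ENNReal.ofReal (1 / 3) * MeasureTheory.volume cantorSet := by
    have : (fun x : ℝ => x / 3) = fun x => (1 / 3 : ℝ) • x := by ext x; simp; ring
    rw [this, image_smul, MeasureTheory.Measure.addHaar_smul]
    norm_num
  have h2 : MeasureTheory.volume ((fun x : ℝ => (2 + x) / 3) '' cantorSet) =
      ENNReal.ofReal (1 / 3) * MeasureTheory.volume cantorSet := by
    have : (fun x : ℝ => (2 + x) / 3) = (fun x => 2 / 3 + x) ∘ (· / 3) := by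
      ext x; simp; ring
    rw [this, image_comp, ← h1, image_add_left, MeasureTheory.measure_preimage_add]
  have h : MeasureTheory.volume cantorSet ≤ ENNReal.ofReal (1 / 3) * MeasureTheory.volume cantorSet
      + ENNReal.ofReal (1 / 3) * MeasureTheory.volume cantorSet := by
    conv_lhs => rw [cantorSet_eq_union_halves]
    exact (MeasureTheory.measure_union_le _ _).trans_eq (by rw [h1, h2])
  have h' := ENNReal.toReal_mono (by finiteness) h
  rw [ENNReal.toReal_add (by finiteness) (by finiteness), ENNReal.toReal_mul,
    ENNReal.toReal_ofReal (by norm_num)] at h'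
  have h0 := ENNReal.toReal_nonneg (a := MeasureTheory.volume cantorSet)
  exact ((ENNReal.toReal_eq_zero_iff _).1 (by linarith)).resolve_right hfin

theorem not_countable_Ioo_diff_cantorSet {p q : ℝ} (hpq : p < q) :
    ¬ (Ioo p q \ cantorSet).Countable := by
  intro h
  have h1 := h.measure_zero MeasureTheory.volume
  rw [MeasureTheory.measure_sdiff_null volume_cantorSet, Real.volume_Ioo] at h1
  simp at h1
  linarith

/-- If a dense set of reals is disjoint from the Cantor set, then the Cantor space is a retract of
its space of cuts. -/
theorem exists_cantor_retract {B : Set ℝ} (hB : ∀ p q : ℝ, p < q → ∃ x ∈ B, p < x ∧ x < q)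
    (hBc : Disjoint B cantorSet) :
    ∃ (κ : C(ℕ → Bool, Cuts B)) (ρ : C(Cuts B, ℕ → Bool)), ∀ e, ρ (κ e) = e := by
  -- For each prefix of length `n`, a point of `B` in the gap that separates the two values of the
  -- next digit.
  have hb : ∀ (n : ℕ) (d : ℕ → Bool), ∃ b : B, ∀ e : ℕ → Bool, (∀ i < n, e i = d i) →
      ((b : ℝ) < cantorPoint e ↔ e n = true) := by
    intro n d
    obtain ⟨p, q, hpq, h⟩ := exists_cantorPoint_gap n d
    obtain ⟨x, hx, hpx, hxq⟩ := hB p q hpq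
    refine ⟨⟨x, hx⟩, fun e he => ?_⟩
    obtain ⟨h1, h2⟩ := h e he
    refine ⟨fun hlt => ?_, fun h => hxq.trans_le (h2 h)⟩
    by_contra hf
    exact hlt.not_ge ((h1 (by simpa using hf)).trans hpx.le)
  choose b hb using hb
  -- An arbitrary cut is decoded by descending the binary tree: the digits read so far select the
  -- point of `B` at which the cut gives the next digit. Each digit depends on finitely many values
  -- of the cut.
  let path : Cuts B → ℕ → (ℕ → Bool) := fun s n =>
    Nat.rec (fun _ => false) (fun n d => Function.update d n (s.1 (b n d))) n
  have hpath : ∀ s n, path s (n + 1) =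
    Function.update (path s n) n (s.1 (b n (path s n))) := fun s n => rfl
  have hlc : ∀ n (s : Cuts B), ∀ᶠ s' in 𝓝 s, path s' n = path s n := by
    intro n s
    induction n with
    | zero => exact Eventually.of_forall fun _ => rfl
    | succ n ih =>
      filter_upwards [ih, (Cuts.isClopen_eval (b n (path s n)) _).isOpen.mem_nhds
        (rfl : s.1 (b n (path s n)) = s.1 (b n (path s n)))] with s' h1 h2
      have h2 : s'.1 (b n (path s n)) = s.1 (b n (path s n)) := h2
      rw [hpath, hpath, h1, h2]
  -- A point of the Cantor set goes to the cut of `B` below it. This is continuous because `B`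
  -- misses the Cantor set.
  let κ : C(ℕ → Bool, Cuts B) :=
    ⟨fun e => ⟨fun x => decide ((x : ℝ) < cantorPoint e), by
      rw [antitone_bool_iff]
      intro x y hxy hy
      simp only [decide_eq_true_eq] at *
      exact lt_of_le_of_lt hxy hy⟩, by
      refine (continuous_pi fun x => ?_).subtype_mk _
      have hx : ∀ e, cantorPoint e ≠ x := fun e he =>
        Set.disjoint_left.1 hBc x.2 (he ▸ cantorPoint_mem e)
      refine continuous_iff_continuousAt.2 fun e => tendsto_nhds_of_eventually_eq ?_
      rcases (hx e).lt_or_gt with h | h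
      · filter_upwards [continuous_cantorPoint.continuousAt.eventually (gt_mem_nhds h)] with e' he'
        simp [h.not_gt, he'.le]
      · filter_upwards [continuous_cantorPoint.continuousAt.eventually (lt_mem_nhds h)] with e' he'
        simp [h, he']⟩
  let ρ : C(Cuts B, ℕ → Bool) :=
    ⟨fun s n => s.1 (b n (path s n)), by
      refine continuous_pi fun n => continuous_iff_continuousAt.2 fun s =>
        tendsto_nhds_of_eventually_eq ?_
      filter_upwards [hlc (n + 1) s] with s' hs'
      have := congrFun hs' n
      simpa [hpath] using this⟩
  refine ⟨κ, ρ, fun e => ?_⟩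
  have key : ∀ n, ∀ i < n, e i = path (κ e) n i := by
    intro n
    induction n with
    | zero => simp
    | succ n ih =>
      intro i hi
      rw [hpath]
      rcases (Nat.lt_succ_iff_lt_or_eq.1 hi) with h | rfl
      · rw [Function.update_of_ne h.ne]; exact ih i h
      · rw [Function.update_self, Bool.eq_iff_iff, ← hb i _ e ih]
        simp [κ]
  ext n
  have := key (n + 1) n (Nat.lt_succ_self n)
  rw [this, hpath, Function.update_self]
  rfl

end CantorRetract

/-! ### Monotone maps to the interval, and functions vanishing on a closed set. -/

section Separation

open unitInterval

variable {K : Type*} [LinearOrder K] [TopologicalSpace K] [OrderTopology K]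

/-- A monotone form of Urysohn's lemma. -/
theorem exists_monotone_continuous_lt {a b : K} (hab : a < b) :
    ∃ g : C(K, ℝ), Monotone g ∧ (∀ x, g x ∈ Icc (0 : ℝ) 1) ∧ g a < g b := by
  obtain ⟨f, hf0, hf1, hf⟩ := exists_continuous_zero_one_of_isClosed (isClosed_Iic (a := a))
    (isClosed_Ici (a := b)) (disjoint_left.2 fun x hx hx' => (hab.trans_le hx').not_ge hx)
  -- The running supremum of a Urysohn function is monotone and still continuous.
  let g : K → ℝ := fun x => sSup (f '' Iic x)
  have hbdd : ∀ x, BddAbove (f '' Iic x) := fun x => ⟨1, by rintro _ ⟨y, -, rfl⟩; exact (hf y).2⟩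
  have hle : ∀ {x y}, y ≤ x → f y ≤ g x := fun {x y} h => le_csSup (hbdd x) ⟨y, h, rfl⟩
  have hge : ∀ {x c}, (∀ y ≤ x, f y ≤ c) → g x ≤ c := fun {x c} h =>
    csSup_le ⟨_, x, le_rfl, rfl⟩ (by rintro _ ⟨y, hy, rfl⟩; exact h y hy)
  have hmono : Monotone g := fun x y hxy => hge fun z hz => hle (hz.trans hxy)
  have hcont : Continuous g := by
    refine continuous_iff_continuousAt.2 fun x => Metric.tendsto_nhds.2 fun ε hε => ?_
    obtain ⟨c, d, hx, hcd, hsub⟩ := exists_Icc_mem_subset_of_mem_nhds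
      (Metric.tendsto_nhds.1 (f.continuous.tendsto x) (ε / 2 / 2) (half_pos (half_pos hε)))
    have key : ∀ y ∈ Icc c d, ∀ z ∈ Icc c d, y ≤ z → g z ≤ g y + ε / 2 := by
      intro y hy z hz hyz
      refine hge fun w hw => ?_
      rcases le_total w y with h | h
      · exact (hle h).trans (by linarith)
      · have h1 : dist (f w) (f x) < ε / 2 / 2 := hsub ⟨hy.1.trans h, hw.trans hz.2⟩
        have h2 : dist (f y) (f x) < ε / 2 / 2 := hsub hy
        rw [Real.dist_eq, abs_lt] at h1 h2
        have := hle (le_refl y)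
        linarith
    filter_upwards [hcd] with y hy
    rw [Real.dist_eq, abs_lt]
    rcases le_total y x with h | h
    · have := key y hy x hx h
      have := hmono h
      constructor <;> linarith
    · have := key x hx y hy h
      have := hmono h
      constructor <;> linarith
  refine ⟨⟨g, hcont⟩, hmono, fun x => ⟨(hf x).1.trans (hle le_rfl), hge fun y _ => (hf y).2⟩, ?_⟩
  calc g a ≤ 0 := hge fun y hy => (hf0 hy).le
    _ < 1 := one_pos
    _ = f b := (hf1 (le_refl b)).symm
    _ ≤ g b := hle le_rfl

/-- Countably many pairs of points of a compact line are separated by one monotone continuous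
function. -/
theorem exists_monotone_continuous_lt_of_countable {T : Set (K × K)} (hT : T.Countable)
    (hlt : ∀ p ∈ T, p.1 < p.2) :
    ∃ q : C(K, I), Monotone q ∧ ∀ p ∈ T, q p.1 < q p.2 := by
  rcases T.eq_empty_or_nonempty with rfl | hne
  · exact ⟨ContinuousMap.const K 0, fun _ _ _ => le_rfl, by simp⟩
  obtain ⟨e, rfl⟩ := hT.exists_eq_range hne
  choose g hg hg01 hglt using fun n => exists_monotone_continuous_lt (hlt (e n) ⟨n, rfl⟩)
  let F : K → ℕ → ℝ := fun x n => (1 : ℝ) / 2 / 2 ^ n * g n x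
  have hs : Summable fun n : ℕ => (1 : ℝ) / 2 / 2 ^ n := summable_geometric_two' 1
  have hF0 : ∀ x n, 0 ≤ F x n := fun x n => mul_nonneg (by positivity) (hg01 n x).1
  have hF1 : ∀ x n, F x n ≤ 1 / 2 / 2 ^ n := fun x n =>
    mul_le_of_le_one_right (by positivity) (hg01 n x).2
  have hsF : ∀ x, Summable (F x) := fun x => hs.of_nonneg_of_le (hF0 x) (hF1 x)
  have hc : Continuous fun x => ∑' n, F x n := by
    refine continuous_tsum (fun n => continuous_const.mul (g n).continuous) hs fun n x => ?_
    rw [Real.norm_of_nonneg (hF0 x n)]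
    exact hF1 x n
  have hmono : ∀ {x y}, x ≤ y → ∀ n, F x n ≤ F y n := fun h n =>
    mul_le_mul_of_nonneg_left (hg n h) (by positivity)
  refine ⟨⟨fun x => ⟨∑' n, F x n, tsum_nonneg (hF0 x), ?_⟩, hc.subtype_mk _⟩, fun x y h => ?_, ?_⟩
  · exact ((hsF x).tsum_le_tsum (hF1 x) hs).trans_eq (tsum_geometric_two' 1)
  · exact (hsF x).tsum_le_tsum (hmono h) (hsF y)
  · rintro _ ⟨n, rfl⟩
    exact Summable.tsum_lt_tsum (i := n) (hmono (hlt (e n) ⟨n, rfl⟩).le)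
      (mul_lt_mul_of_pos_left (hglt n) (by positivity)) (hsF _) (hsF _)

variable [CompactSpace K]

/-- The restriction of continuous functions to a subspace. -/
def restrictCLM {S : Type*} [TopologicalSpace S] (L : Set S) : C(S, ℝ) →L[ℝ] C(L, ℝ) :=
  (⟨Subtype.val, continuous_subtype_val⟩ : C(L, S)).compRightCLM

/-- If a map to the unit interval separates the points outside a closed set from all other points,
then the functions that vanish on this set form a complemented subspace of `C(I)`. -/
theorem exists_ker_restrict_retract {L : Set K} (hL : IsClosed L) (q : C(K, I))
    (hq : ∀ x y, q x = q y → x = y ∨ x ∈ L ∧ y ∈ L) :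
    ∃ (j : (restrictCLM L).ker →L[ℝ] C(I, ℝ)) (r : C(I, ℝ) →L[ℝ] (restrictCLM L).ker),
      ∀ z, r (j z) = z := by
  obtain ⟨E, hE⟩ := exists_extension_operator hL
  have hM : IsClosed (range q) := (isCompact_range q.continuous).isClosed
  obtain ⟨G, hG⟩ := exists_extension_operator hM
  have : CompactSpace (range q) := isCompact_iff_compactSpace.1 hM.isCompact
  let Q : C(K, range q) := ⟨rangeFactorization q, q.continuous.subtype_mk _⟩
  have hQs : Function.Surjective Q := rangeFactorization_surjective
  have hQ : IsQuotientMap Q := IsQuotientMap.of_surjective_continuous hQs Q.continuous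
  have hker : ∀ (z : (restrictCLM L).ker) (x : L), z.1 x = 0 := fun z x =>
    congrArg (fun f : C(L, ℝ) => f x) z.2
  have hfac : ∀ z : (restrictCLM L).ker, Function.FactorsThrough z.1 Q := fun z x y hxy => by
    rcases hq x y (congrArg Subtype.val hxy) with rfl | ⟨hx, hy⟩
    · rfl
    · rw [hker z ⟨x, hx⟩, hker z ⟨y, hy⟩]
  have hlift : ∀ z x, hQ.lift z.1 (hfac z) (Q x) = z.1 x := fun z x =>
    congrArg (fun f : C(K, ℝ) => f x) (hQ.lift_comp z.1 (hfac z))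
  -- A function vanishing on `L` is constant on the fibres of `q`, so it descends to the image of
  -- `q`; `G` then extends it to the interval.
  let d : (restrictCLM L).ker →L[ℝ] C(range q, ℝ) := LinearMap.mkContinuous
    ({
      toFun := fun z => hQ.lift z.1 (hfac z)
      map_add' := fun z w => by
        ext y
        obtain ⟨x, rfl⟩ := hQs y
        rw [ContinuousMap.add_apply, hlift, hlift, hlift]
        rfl
      map_smul' := fun c z => by
        ext y
        obtain ⟨x, rfl⟩ := hQs y
        rw [ContinuousMap.smul_apply, hlift, hlift]
        rfl } : (restrictCLM L).ker →ₗ[ℝ] C(range q, ℝ)) 1 fun z => by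
      rw [one_mul]
      refine (ContinuousMap.norm_le _ (norm_nonneg z)).2 fun y => ?_
      obtain ⟨x, rfl⟩ := hQs y
      exact (congrArg norm (hlift z x)).trans_le (z.1.norm_coe_le_norm x)
  -- The projection that subtracts the extension of the restriction to `L`.
  let P : C(K, ℝ) →L[ℝ] (restrictCLM L).ker :=
    (ContinuousLinearMap.id ℝ _ - E.comp (restrictCLM L)).codRestrict _ fun f => by
      ext x
      change f x - E (restrictCLM L f) x = 0
      rw [hE, sub_eq_zero]
      rfl
  refine ⟨G.comp d, P.comp q.compRightCLM, fun z => ?_⟩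
  have hz : q.compRightCLM (G (d z)) = z.1 := by
    ext x
    exact (hG (d z) (Q x)).trans (hlift z x)
  refine Subtype.ext ?_
  change q.compRightCLM (G (d z)) - E (restrictCLM L (q.compRightCLM (G (d z)))) = z.1
  rw [hz, show restrictCLM L z.1 = 0 from z.2, map_zero, sub_zero]

end Separation

/-! ### `ℵ₁`-dense sets of reals and Baumgartner's Axiom. -/

section DenseSets

/-- An uncountable set has at least `ℵ₁` points, so only countability has to be tested locally. -/
theorem isCardinalDense_aleph_one_iff {A : Set ℝ} : IsCardinalDense (ℵ_ 1) A ↔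
    #A ≤ ℵ_ 1 ∧ ∀ p q : ℝ, p < q → ¬ (A ∩ Ioo p q).Countable := by
  constructor
  · refine fun h => ⟨?_, fun p q hpq hc => ?_⟩
    · have := h univ isOpen_univ univ_nonempty
      rw [univ_inter] at this
      exact this.le
    · have := h _ isOpen_Ioo (nonempty_Ioo.2 hpq)
      rw [inter_comm] at this
      exact ((Cardinal.le_aleph0_iff_set_countable.2 hc).trans_lt
        Cardinal.aleph0_lt_aleph_one).ne this
  · rintro ⟨h1, h2⟩ U hU ⟨x, hx⟩
    refine le_antisymm ((Cardinal.mk_le_mk_of_subset inter_subset_right).trans h1) ?_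
    obtain ⟨p, q, hpq, hsub⟩ := mem_nhds_iff_exists_Ioo_subset.1 (hU.mem_nhds hx)
    rw [Cardinal.aleph_one_le_iff, ← not_le, Cardinal.le_aleph0_iff_set_countable]
    intro hc
    refine h2 p q (hpq.1.trans hpq.2) (Set.Countable.mono ?_ hc)
    exact fun y hy => ⟨hsub hy.2, hy.1⟩

theorem IsCardinalDense.exists_between {A : Set ℝ} (hA : IsCardinalDense (ℵ_ 1) A) {p q : ℝ}
    (hpq : p < q) : ∃ x ∈ A, p < x ∧ x < q := by
  by_contra! h
  refine (isCardinalDense_aleph_one_iff.1 hA).2 p q hpq (countable_empty.mono fun x hx => ?_)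
  exact (h x hx.1 hx.2.1).not_gt hx.2.2

/-- Take `ℵ₁` points of each rational interval outside the Cantor set, which is null. -/
theorem exists_isCardinalDense_disjoint_cantorSet :
    ∃ A : Set ℝ, IsCardinalDense (ℵ_ 1) A ∧ Disjoint A cantorSet := by
  have h : ∀ p : {p : ℚ × ℚ // p.1 < p.2}, ∃ S ⊆ Ioo (p.1.1 : ℝ) p.1.2 \ cantorSet,
      #S = ℵ_ 1 := fun p => by
    rw [← Cardinal.le_mk_iff_exists_subset, Cardinal.aleph_one_le_iff, ← not_le,
      Cardinal.le_aleph0_iff_set_countable]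
    exact not_countable_Ioo_diff_cantorSet (by exact_mod_cast p.2)
  choose S hS hcard using h
  refine ⟨⋃ p, S p, isCardinalDense_aleph_one_iff.2 ⟨?_, fun p q hpq hc => ?_⟩, ?_⟩
  · refine (Cardinal.mk_iUnion_le_sum_mk).trans ?_
    simp only [hcard, Cardinal.sum_const, Cardinal.lift_id]
    refine Cardinal.mul_le_of_le (Cardinal.aleph0_le_aleph 1) ?_ le_rfl
    exact Cardinal.mk_le_aleph0.trans (Cardinal.aleph0_le_aleph 1)
  · obtain ⟨r, hpr, hrq⟩ := exists_rat_btwn hpq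
    obtain ⟨s, hrs, hsq⟩ := exists_rat_btwn hrq
    have hrs' : r < s := by exact_mod_cast hrs
    have hsub : S ⟨(r, s), hrs'⟩ ⊆ (⋃ p, S p) ∩ Ioo p q := fun x hx =>
      ⟨mem_iUnion.2 ⟨_, hx⟩, hpr.trans (hS _ hx).1.1, (hS _ hx).1.2.trans hsq⟩
    have hc' := hc.mono hsub
    exact ((Cardinal.le_aleph0_iff_set_countable.2 hc').trans_lt
      Cardinal.aleph0_lt_aleph_one).ne (hcard _)
  · rw [disjoint_iUnion_left]
    exact fun p => disjoint_left.2 fun x hx => (hS p hx).2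

theorem BaumgartnerAxiom.nonempty_orderIso (hBA : BaumgartnerAxiom (ℵ_ 1)) {X : Type*}
    [LinearOrder X] {γ : X → ℝ} (hγ : StrictMono γ) (hd : IsCardinalDense (ℵ_ 1) (range γ))
    {B : Set ℝ} (hB : IsCardinalDense (ℵ_ 1) B) : Nonempty (B ≃o X) := by
  obtain ⟨e⟩ := hBA _ _ hB hd
  exact ⟨e.trans hγ.orderIso.symm⟩

/-- An order isomorphism of the real interval `(a, c)` with `ℝ` turns the part of `B` inside it into
an `ℵ₁`-dense set. -/
theorem BaumgartnerAxiom.nonempty_orderIso_Ioo (hBA : BaumgartnerAxiom (ℵ_ 1)) {B : Set ℝ}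
    (hB : IsCardinalDense (ℵ_ 1) B) {a c : B} (hac : a < c) : Nonempty (B ≃o Ioo a c) := by
  have hac' : (0 : ℝ) < (c - a) / 2 := half_pos (sub_pos.2 hac)
  have hne : (c : ℝ) - a ≠ 0 := sub_ne_zero.2 (Subtype.coe_injective.ne hac.ne')
  let σ : ℝ ≃o Ioo (-1 : ℝ) 1 := orderIsoIooNegOneOne ℝ
  let l : ℝ → ℝ := fun x => (x - (a + c) / 2) / ((c - a) / 2)
  have hl : ∀ x ∈ Ioo (a : ℝ) c, l x ∈ Ioo (-1 : ℝ) 1 := fun x hx => by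
    simp only [l, mem_Ioo]
    rw [lt_div_iff₀ hac', div_lt_iff₀ hac']
    constructor <;> linarith [hx.1, hx.2]
  have hlm : StrictMono l := fun x y h => div_lt_div_of_pos_right (by linarith) hac'
  let γ : Ioo a c → ℝ := fun x => σ.symm ⟨l x, hl x ⟨x.2.1, x.2.2⟩⟩
  have hγ : StrictMono γ := fun x y h => σ.symm.strictMono (hlm h)
  refine hBA.nonempty_orderIso hγ ?_ hB
  obtain ⟨h1, h2⟩ := isCardinalDense_aleph_one_iff.1 hB
  refine isCardinalDense_aleph_one_iff.2 ⟨?_, fun p q hpq hc => ?_⟩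
  · exact (Cardinal.mk_range_le.trans (Cardinal.mk_subtype_le _)).trans h1
  · let g : ℝ → ℝ := fun x => (a + c) / 2 + (c - a) / 2 * σ x
    have hg : ∀ x, g x ∈ Ioo (a : ℝ) c := fun x => by
      have := (σ x).2
      simp only [g, mem_Ioo]
      constructor <;> nlinarith [this.1, this.2]
    have hgm : StrictMono g := fun x y h => by
      have : (σ x : ℝ) < σ y := σ.strictMono h
      simp only [g]
      nlinarith
    refine h2 (g p) (g q) (hgm hpq) ?_
    refine (hc.image g).mono fun y hy => ?_
    have hy' : y ∈ Ioo (a : ℝ) c := ⟨(hg p).1.trans hy.2.1, hy.2.2.trans (hg q).2⟩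
    have hgy : g (σ.symm ⟨l y, hl y hy'⟩) = y := by
      simp only [g, OrderIso.apply_symm_apply, l]
      field_simp
      ring
    refine ⟨σ.symm ⟨l y, hl y hy'⟩, ⟨⟨⟨⟨y, hy.1⟩, hy'.1, hy'.2⟩, rfl⟩, ?_, ?_⟩, hgy⟩
    · rw [← hgm.lt_iff_lt, hgy]; exact hy.2.1
    · rw [← hgm.lt_iff_lt, hgy]; exact hy.2.2

/-- Under Baumgartner's Axiom, some space `C(Cuts B)` absorbs all complemented subspaces of `C(I)`,
and itself. -/
theorem BaumgartnerAxiom.exists_absorbing (hBA : BaumgartnerAxiom (ℵ_ 1)) :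
    ∃ B : Set ℝ, IsCardinalDense (ℵ_ 1) B ∧
      Nonempty (C(Cuts B, ℝ) ≃L[ℝ] C(Cuts B, ℝ) × C(Cuts B, ℝ)) ∧
      ∀ (Z : Type*) [NormedAddCommGroup Z] [NormedSpace ℝ Z] (j : Z →L[ℝ] C(unitInterval, ℝ))
        (r : C(unitInterval, ℝ) →L[ℝ] Z), (∀ z, r (j z) = z) →
        Nonempty (C(Cuts B, ℝ) ≃L[ℝ] C(Cuts B, ℝ) × Z) := by
  obtain ⟨B, hB, hBc⟩ := exists_isCardinalDense_disjoint_cantorSet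
  have hx : ∀ n : ℕ, ∃ x ∈ B, (n : ℝ) < x ∧ x < n + 1 := fun n =>
    hB.exists_between (lt_add_one _)
  choose x hxB hx hx' using hx
  let b : ℕ → B := fun n => ⟨x n, hxB n⟩
  have hb : StrictMono b := strictMono_nat_of_lt_succ fun n => by
    have := hx (n + 1)
    push_cast at this
    exact (hx' n).trans this
  obtain ⟨I, p, hp⟩ := Cuts.exists_nullSequence_retract hb fun n =>
    (hBA.nonempty_orderIso_Ioo hB (hb (Nat.lt_succ_self n))).some
  obtain ⟨κ, ρ, hκ⟩ := exists_cantor_retract (fun p q h => hB.exists_between h) hBc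
  obtain ⟨φ, R, hR⟩ := Milutin.exists_averaging_operator
  refine ⟨B, hB, nonempty_equiv_prod_of_nullSequence_retract I p hp (.id ℝ _) (.id ℝ _)
    fun _ => rfl, fun Z _ _ j r hr => ?_⟩
  -- `C(I)` embeds in `C(Cuts B)` through the Cantor space by `φ` and `ρ`; restricting along `κ` and
  -- averaging by `R` inverts this.
  refine nonempty_equiv_prod_of_nullSequence_retract I p hp
    (ρ.compRightCLM.comp (φ.compRightCLM.comp j)) (r.comp (R.comp κ.compRightCLM)) fun z => ?_
  have : κ.compRightCLM (ρ.compRightCLM (φ.compRightCLM (j z))) = (j z).comp φ := by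
    ext e
    exact congrArg (fun e => j z (φ e)) (hκ e)
  change r (R (κ.compRightCLM (ρ.compRightCLM (φ.compRightCLM (j z))))) = z
  rw [this, hR, hr]

end DenseSets

/-! ### Jumps and weight. -/

section Jumps

/-- The left endpoints of the jumps of a linear order. -/
def jumps (K : Type*) [LinearOrder K] : Set K := {x | ∃ y, x ⋖ y}

variable {K : Type*} [LinearOrder K]

theorem subsingleton_setOf_covBy (x : K) : {y | x ⋖ y}.Subsingleton :=
  fun _ hy _ hz => hy.unique_right hz

variable [TopologicalSpace K] [OrderTopology K]

theorem exists_mem_Ioo_of_dense {D : Set K} (hD : Dense D) {x y : K} (h : (Ioo x y).Nonempty) :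
    ∃ d ∈ D, x < d ∧ d < y := by
  obtain ⟨d, hd, hdD⟩ := hD.inter_open_nonempty _ isOpen_Ioo h
  exact ⟨d, hdD, hd⟩

/-- If `j` is the left end of a jump, then `Iic j` is open, so some basic set has greatest element
`j`. -/
theorem mk_jumps_le_topologicalWeight : #(jumps K) ≤ topologicalWeight K := by
  obtain ⟨ℬ, hℬ, hcard⟩ := exists_basis_card_eq_topologicalWeight K
  rw [← hcard]
  have h : ∀ j : jumps K, ∃ U ∈ ℬ, (j : K) ∈ U ∧ U ⊆ Iic (j : K) := fun ⟨j, k, hjk⟩ => by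
    have : IsOpen (Iic j) := by
      rw [← hjk.Iio_eq]
      exact isOpen_Iio
    exact hℬ.exists_subset_of_mem_open (mem_Iic.2 le_rfl) this
  choose U hU hjU hsub using h
  refine Cardinal.mk_le_of_injective (f := fun j => (⟨U j, hU j⟩ : ℬ)) fun i j hij => ?_
  have hij : U i = U j := congrArg Subtype.val hij
  exact Subtype.ext (le_antisymm (hsub j (hij ▸ hjU i)) (hsub i (hij ▸ hjU j)))

/-- The open rays from the points of a countable dense set and from the ends of the jumps generate
the topology. -/
theorem secondCountableTopology_of_countable_jumps [TopologicalSpace.SeparableSpace K]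
    (hJ : (jumps K).Countable) : SecondCountableTopology K := by
  obtain ⟨D, hDc, hD⟩ := TopologicalSpace.exists_countable_dense K
  let J' : Set K := ⋃ x ∈ jumps K, {y | x ⋖ y}
  let E : Set K := D ∪ jumps K ∪ J'
  have hE : E.Countable := (hDc.union hJ).union
    (hJ.biUnion fun x _ => (subsingleton_setOf_covBy x).countable)
  let b : Set (Set K) := Ioi '' E ∪ Iio '' E
  refine ⟨⟨b, (hE.image _).union (hE.image _), le_antisymm ?_ ?_⟩⟩
  · refine le_generateFrom ?_
    rintro _ (⟨e, -, rfl⟩ | ⟨e, -, rfl⟩)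
    exacts [isOpen_Ioi, isOpen_Iio]
  · rw [OrderTopology.topology_eq_generate_intervals (α := K)]
    refine le_generateFrom ?_
    rintro _ ⟨a, rfl | rfl⟩
    · have : Ioi a = ⋃ e ∈ E ∩ Ici a, Ioi e := by
        ext y
        simp only [mem_iUnion, mem_Ioi, exists_prop]
        refine ⟨fun h => ?_, fun ⟨e, he, hey⟩ => lt_of_le_of_lt he.2 hey⟩
        by_cases hne : (Ioo a y).Nonempty
        · obtain ⟨d, hd, had, hdy⟩ := exists_mem_Ioo_of_dense hD hne
          exact ⟨d, ⟨Or.inl (Or.inl hd), had.le⟩, hdy⟩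
        · exact ⟨a, ⟨Or.inl (Or.inr ⟨y, h, fun z h1 h2 => hne ⟨z, h1, h2⟩⟩), le_rfl⟩, h⟩
      rw [this]
      let _ := TopologicalSpace.generateFrom b
      exact isOpen_biUnion fun e he =>
        TopologicalSpace.isOpen_generateFrom_of_mem (Or.inl ⟨e, he.1, rfl⟩)
    · have : Iio a = ⋃ e ∈ E ∩ Iic a, Iio e := by
        ext y
        simp only [mem_iUnion, mem_Iio, exists_prop]
        refine ⟨fun h => ?_, fun ⟨e, he, hey⟩ => lt_of_lt_of_le hey he.2⟩
        by_cases hne : (Ioo y a).Nonempty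
        · obtain ⟨d, hd, hyd, hda⟩ := exists_mem_Ioo_of_dense hD hne
          exact ⟨d, ⟨Or.inl (Or.inl hd), hda.le⟩, hyd⟩
        · have hya : y ⋖ a := ⟨h, fun z h1 h2 => hne ⟨z, h1, h2⟩⟩
          exact ⟨a, ⟨Or.inr (mem_biUnion (⟨a, hya⟩ : y ∈ jumps K) hya), le_rfl⟩, h⟩
      rw [this]
      let _ := TopologicalSpace.generateFrom b
      exact isOpen_biUnion fun e he =>
        TopologicalSpace.isOpen_generateFrom_of_mem (Or.inr ⟨e, he.1, rfl⟩)

theorem not_countable_jumps [TopologicalSpace.SeparableSpace K]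
    (hK : ℵ_ 1 ≤ topologicalWeight K) : ¬ (jumps K).Countable := by
  intro h
  have := secondCountableTopology_of_countable_jumps h
  have hle : topologicalWeight K ≤ ℵ₀ :=
    (csInf_le' (show #(TopologicalSpace.countableBasis K) ∈ {c | ∃ B : Set (Set K),
      TopologicalSpace.IsTopologicalBasis B ∧ #B = c} from
        ⟨_, TopologicalSpace.isBasis_countableBasis K, rfl⟩)).trans
      (Cardinal.le_aleph0_iff_set_countable.2 (TopologicalSpace.countable_countableBasis K))
  exact ((hK.trans hle).trans_lt Cardinal.aleph0_lt_aleph_one).false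

/-- The intervals from `x` to points of a countable dense set in `C` cover all of `C ∩ Ici x` except
the points beyond every such point. No three of these exceptions exist: a dense point would lie
between the outer two. -/
theorem countable_inter_Ici_of_countable_Icc [TopologicalSpace.SeparableSpace K] {C J : Set K}
    (hC : C.OrdConnected) {x : K} (h : ∀ y ∈ C, (Icc x y ∩ J).Countable) :
    (C ∩ Ici x ∩ J).Countable := by
  obtain ⟨D, hDc, hD⟩ := TopologicalSpace.exists_countable_dense K
  let R : Set K := {y | y ∈ C ∧ x ≤ y ∧ ∀ d ∈ D ∩ C, d < y}
  have h3 : ∀ y₁ ∈ R, ∀ y₂ ∈ R, ∀ y₃ ∈ R, y₁ < y₂ → y₂ < y₃ → False := by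
    intro y₁ h₁ y₂ _ y₃ h₃ h12 h23
    obtain ⟨d, hd, h1d, hd3⟩ := exists_mem_Ioo_of_dense hD ⟨y₂, h12, h23⟩
    exact (h₁.2.2 d ⟨hd, hC.out h₁.1 h₃.1 ⟨h1d.le, hd3.le⟩⟩).not_gt h1d
  have hR : R.Countable := by
    rcases R.eq_empty_or_nonempty with h0 | ⟨y, hy⟩
    · rw [h0]; exact countable_empty
    have h1 : (R ∩ Ioi y).Subsingleton := fun a ha b hb => by
      by_contra hne
      rcases lt_or_gt_of_ne hne with hab | hab
      · exact h3 y hy a ha.1 b hb.1 ha.2 hab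
      · exact h3 y hy b hb.1 a ha.1 hb.2 hab
    have h2 : (R ∩ Iio y).Subsingleton := fun a ha b hb => by
      by_contra hne
      rcases lt_or_gt_of_ne hne with hab | hab
      · exact h3 a ha.1 b hb.1 y hy hab hb.2
      · exact h3 b hb.1 a ha.1 y hy hab ha.2
    refine ((h1.countable.union h2.countable).union (countable_singleton y)).mono fun z hz => ?_
    rcases lt_trichotomy z y with h | h | h
    · exact Or.inl (Or.inr ⟨hz, h⟩)
    · exact Or.inr h
    · exact Or.inl (Or.inl ⟨hz, h⟩)
  refine (((hDc.mono inter_subset_left).biUnion fun d (hd : d ∈ D ∩ C) => h d hd.2).union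
    hR).mono fun y hy => ?_
  by_cases hyd : ∃ d ∈ D ∩ C, y ≤ d
  · obtain ⟨d, hd, hyd⟩ := hyd
    exact Or.inl (mem_biUnion hd ⟨⟨hy.1.2, hyd⟩, hy.2⟩)
  · push Not at hyd
    exact Or.inr ⟨hy.1.1, hy.1.2, hyd⟩

end Jumps

/-! ### Classes of points with countably many marked points between them. -/

section Near

variable {K : Type*} [LinearOrder K]

/-- Two points of a linear order are near with respect to a set if this set has only countably many
points between them. -/
def Near (J : Set K) (x y : K) : Prop := (Icc x y ∩ J).Countable ∧ (Icc y x ∩ J).Countable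

namespace Near

variable {J : Set K} {x y z : K}

theorem of_le (h : x ≤ y) (hc : (Icc x y ∩ J).Countable) : Near J x y := by
  refine ⟨hc, (countable_singleton x).mono fun z hz => ?_⟩
  exact le_antisymm hz.1.2 (h.trans hz.1.1)

theorem refl (x : K) : Near J x x :=
  of_le le_rfl ((countable_singleton x).mono fun z hz => by simpa using hz.1)

theorem symm (h : Near J x y) : Near J y x := ⟨h.2, h.1⟩

theorem trans (h : Near J x y) (h' : Near J y z) : Near J x z := by
  constructor
  · refine (h.1.union h'.1).mono fun w hw => ?_
    rcases le_total w y with hwy | hwy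
    · exact Or.inl ⟨⟨hw.1.1, hwy⟩, hw.2⟩
    · exact Or.inr ⟨⟨hwy, hw.1.2⟩, hw.2⟩
  · refine (h.2.union h'.2).mono fun w hw => ?_
    rcases le_total w y with hwy | hwy
    · exact Or.inr ⟨⟨hw.1.1, hwy⟩, hw.2⟩
    · exact Or.inl ⟨⟨hwy, hw.1.2⟩, hw.2⟩

theorem left_of_le_of_le (h : Near J x z) (hxy : x ≤ y) (hyz : y ≤ z) : Near J x y :=
  of_le hxy (h.1.mono (inter_subset_inter_left _ (Icc_subset_Icc_right hyz)))

theorem right_of_le_of_le (h : Near J x z) (hxy : x ≤ y) (hyz : y ≤ z) : Near J y z :=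
  of_le hyz (h.1.mono (inter_subset_inter_left _ (Icc_subset_Icc_left hxy)))

theorem of_covBy (h : x ⋖ y) : Near J x y :=
  of_le h.le (Set.Countable.mono inter_subset_left (by
    rw [h.Icc_eq]
    exact (Set.toFinite _).countable))

theorem ordConnected (J : Set K) (x : K) : {y | Near J x y}.OrdConnected :=
  ⟨fun _ ha _ hb _ hc => ha.trans ((ha.symm.trans hb).left_of_le_of_le hc.1 hc.2)⟩

theorem dual_iff {x y : K} : Near (K := Kᵒᵈ) J x y ↔ Near J x y := by
  have : ∀ a b : K, Icc (α := Kᵒᵈ) a b = Icc b a := fun a b => ext fun z => and_comm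
  unfold Near
  rw [this, this]
  exact and_comm

variable [TopologicalSpace K] [OrderTopology K] [TopologicalSpace.SeparableSpace K]

theorem countable_Ici (J : Set K) (x : K) : ({y | Near J x y} ∩ Ici x ∩ J).Countable :=
  countable_inter_Ici_of_countable_Icc (ordConnected J x) fun _ hy => hy.1

/-- The supremum exists by compactness. It belongs to the class because, by separability, the whole
class above `x` has only countably many marked points. -/
theorem exists_isGreatest [CompactSpace K] (J : Set K) (x : K) :
    ∃ v, IsGreatest {y | Near J x y} v := by
  let C : Set K := {y | Near J x y}
  have hxC : x ∈ C := refl x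
  obtain ⟨v, hv, hmax⟩ := (isClosed_closure (s := C)).isCompact.exists_isGreatest
    ⟨x, subset_closure hxC⟩
  refine ⟨v, of_le (hmax (subset_closure hxC)) ?_, fun y hy => hmax (subset_closure hy)⟩
  refine ((countable_Ici J x).union (countable_singleton v)).mono fun y hy => ?_
  rcases hy.1.2.eq_or_lt with h | h
  · exact Or.inr h
  · obtain ⟨c, hyc, hc⟩ := mem_closure_iff.1 hv _ isOpen_Ioi h
    exact Or.inl ⟨⟨(show Near J x c from hc).left_of_le_of_le hy.1.1 (le_of_lt hyc), hy.1.1⟩, hy.2⟩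

theorem exists_isLeast [CompactSpace K] (J : Set K) (x : K) :
    ∃ u, IsLeast {y | Near J x y} u := by
  have : CompactSpace Kᵒᵈ := ‹CompactSpace K›
  have : TopologicalSpace.SeparableSpace Kᵒᵈ := ‹TopologicalSpace.SeparableSpace K›
  obtain ⟨u, hu, hmin⟩ := exists_isGreatest (K := Kᵒᵈ) J x
  exact ⟨u, dual_iff.1 hu, fun y hy => hmin (dual_iff.2 hy)⟩

end Near

end Near

/-! ### The skeleton of a separable compact line. -/

section Skeleton

variable {K : Type*} [LinearOrder K]

/-- Two points are near if there are only countably many jumps between them. -/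
abbrev JumpNear (x y : K) : Prop := Near (jumps K) x y

variable [TopologicalSpace K] [OrderTopology K] [CompactSpace K]
  [TopologicalSpace.SeparableSpace K]

/-- The greatest point near a given one. -/
noncomputable def nearMax (x : K) : K := (Near.exists_isGreatest (jumps K) x).choose

/-- The least point near a given one. -/
noncomputable def nearMin (x : K) : K := (Near.exists_isLeast (jumps K) x).choose

variable {x y z : K}

theorem jumpNear_nearMax (x : K) : JumpNear x (nearMax x) :=
  (Near.exists_isGreatest (jumps K) x).choose_spec.1

theorem jumpNear_nearMin (x : K) : JumpNear x (nearMin x) :=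
  (Near.exists_isLeast (jumps K) x).choose_spec.1

theorem JumpNear.le_nearMax (h : JumpNear x y) : y ≤ nearMax x :=
  (Near.exists_isGreatest (jumps K) x).choose_spec.2 h

theorem JumpNear.nearMin_le (h : JumpNear x y) : nearMin x ≤ y :=
  (Near.exists_isLeast (jumps K) x).choose_spec.2 h

theorem le_nearMax (x : K) : x ≤ nearMax x := JumpNear.le_nearMax (Near.refl x)

theorem nearMin_le (x : K) : nearMin x ≤ x := JumpNear.nearMin_le (Near.refl x)

theorem JumpNear.nearMax_eq (h : JumpNear x y) : nearMax x = nearMax y :=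
  le_antisymm (JumpNear.le_nearMax (h.symm.trans (jumpNear_nearMax x)))
    (JumpNear.le_nearMax (h.trans (jumpNear_nearMax y)))

theorem JumpNear.nearMin_eq (h : JumpNear x y) : nearMin x = nearMin y :=
  le_antisymm (JumpNear.nearMin_le (h.trans (jumpNear_nearMin y)))
    (JumpNear.nearMin_le (h.symm.trans (jumpNear_nearMin x)))

theorem jumpNear_of_mem_Icc (h : y ∈ Icc (nearMin x) (nearMax x)) : JumpNear x y :=
  (Near.ordConnected _ x).out (jumpNear_nearMin x) (jumpNear_nearMax x) h

theorem countable_near_inter_jumps (x : K) : ({y | JumpNear x y} ∩ jumps K).Countable := by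
  have h := ((jumpNear_nearMin x).symm.trans (jumpNear_nearMax x)).1
  refine Set.Countable.mono ?_ h
  exact fun y hy => ⟨⟨JumpNear.nearMin_le hy.1, JumpNear.le_nearMax hy.1⟩, hy.2⟩

/-- Between the greatest point near `x` and the least point near `y` there is a further point;
otherwise the two classes would cover `[x, y]`, leaving only countably many jumps. -/
theorem exists_between_of_not_jumpNear {D : Set K} (hD : Dense D) (hxy : x < y)
    (h : ¬ JumpNear x y) : ∃ d ∈ D, x < d ∧ d < y ∧ ¬ JumpNear x d ∧ ¬ JumpNear d y := by
  have hne : (Ioo (nearMax x) (nearMin y)).Nonempty := by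
    by_contra hne
    rw [not_nonempty_iff_eq_empty] at hne
    refine h (Near.of_le hxy.le ((((jumpNear_nearMax x).1.union
      (jumpNear_nearMin y).2)).mono fun z hz => ?_))
    rcases le_or_gt z (nearMax x) with h1 | h1
    · exact Or.inl ⟨⟨hz.1.1, h1⟩, hz.2⟩
    rcases le_or_gt (nearMin y) z with h2 | h2
    · exact Or.inr ⟨⟨h2, hz.1.2⟩, hz.2⟩
    · exact (hne.subset ⟨h1, h2⟩ : z ∈ (∅ : Set K)).elim
  obtain ⟨d, hd, h1, h2⟩ := exists_mem_Ioo_of_dense hD hne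
  exact ⟨d, hd, (le_nearMax x).trans_lt h1, h2.trans_le (nearMin_le y),
    fun h => (JumpNear.le_nearMax h).not_gt h1, fun h => (JumpNear.nearMin_le h.symm).not_gt h2⟩

variable [BoundedOrder K]

variable (K) in
/-- The least points of the nontrivial classes of near points, other than the two extreme ones. -/
def classMins : Set K :=
  {x | nearMin x = x ∧ x < nearMax x ∧ ¬ JumpNear ⊥ x ∧ ¬ JumpNear x ⊤}

variable (K) in
/-- The endpoints of the classes of near points, except for the extreme points of the order. -/
def skeleton : Set K :=
  {x | (nearMin x = x ∧ ¬ JumpNear ⊥ x) ∨ (nearMax x = x ∧ ¬ JumpNear x ⊤)}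

theorem not_jumpNear_of_mem_classMins {b c : K} (hb : b ∈ classMins K) (hc : c ∈ classMins K)
    (h : b ≠ c) : ¬ JumpNear b c := fun hbc => h (by
  rw [← hb.1, ← hc.1, hbc.nearMin_eq])

/-- If the least point of a nontrivial class is not the left end of a jump, the class contains a
point of the countable dense set. -/
theorem countable_classMins_diff_jumps : (classMins K \ jumps K).Countable := by
  obtain ⟨D, hDc, hD⟩ := TopologicalSpace.exists_countable_dense K
  refine (hDc.image nearMin).mono fun x hx => ?_
  have hne : (Ioo x (nearMax x)).Nonempty := by
    by_contra hne
    exact hx.2 ⟨_, hx.1.2.1, fun z h1 h2 => hne ⟨z, h1, h2⟩⟩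
  obtain ⟨d, hd, h1, h2⟩ := exists_mem_Ioo_of_dense hD hne
  refine ⟨d, hd, ?_⟩
  rw [← hx.1.1]
  exact (JumpNear.nearMin_eq (jumpNear_of_mem_Icc ⟨(nearMin_le x).trans h1.le, h2.le⟩)).symm

theorem mk_classMins_le (hJ : #(jumps K) ≤ ℵ_ 1) : #(classMins K) ≤ ℵ_ 1 := by
  have : classMins K ⊆ (classMins K \ jumps K) ∪ jumps K := fun x hx => by
    by_cases h : x ∈ jumps K
    · exact Or.inr h
    · exact Or.inl ⟨hx, h⟩
  refine (Cardinal.mk_le_mk_of_subset this).trans ((Cardinal.mk_union_le _ _).trans ?_)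
  refine Cardinal.add_le_of_le (Cardinal.aleph0_le_aleph 1) ?_ hJ
  exact (Cardinal.le_aleph0_iff_set_countable.2 countable_classMins_diff_jumps).trans
    (Cardinal.aleph0_le_aleph 1)

/-- All but countably many jumps start at a class minimum: any other jump starts in an extreme class
or inside a class that meets the countable dense set, and each of these countably many classes has
countably many jumps. -/
theorem not_countable_classMins_inter_Ioo (hxy : x < y) (h : ¬ JumpNear x y) :
    ¬ (classMins K ∩ Ioo x y).Countable := by
  intro hc
  obtain ⟨D, hDc, hD⟩ := TopologicalSpace.exists_countable_dense K
  refine h (Near.of_le hxy.le ?_)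
  have hcov : (⋃ d ∈ D ∪ {⊥, ⊤}, {y | JumpNear d y} ∩ jumps K).Countable :=
    (hDc.union (Set.toFinite _).countable).biUnion fun d _ => countable_near_inter_jumps d
  refine ((hcov.union hc).union (Set.toFinite {x, y}).countable).mono fun j hj => ?_
  by_contra hnot
  simp only [mem_union, not_or, mem_iUnion, not_exists, mem_insert_iff, mem_singleton_iff] at hnot
  obtain ⟨⟨hn1, hn2⟩, hnx, hny⟩ := hnot
  have hbot : ¬ JumpNear ⊥ j := fun h => hn1 ⊥ (Or.inr (Or.inl rfl)) ⟨h, hj.2⟩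
  have htop : ¬ JumpNear j ⊤ := fun h => hn1 ⊤ (Or.inr (Or.inr rfl)) ⟨h.symm, hj.2⟩
  obtain ⟨k, hjk⟩ := hj.2
  have hlt : j < nearMax j := hjk.lt.trans_le (JumpNear.le_nearMax (Near.of_covBy hjk))
  have hmin : nearMin j = j := by
    by_contra hne
    have hlt' : nearMin j < j := lt_of_le_of_ne (nearMin_le j) hne
    obtain ⟨d, hd, h1, h2⟩ := exists_mem_Ioo_of_dense hD ⟨j, hlt', hlt⟩
    exact hn1 d (Or.inl hd) ⟨(jumpNear_of_mem_Icc ⟨h1.le, h2.le⟩).symm, hj.2⟩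
  exact hn2 ⟨⟨hmin, hlt, hbot, htop⟩, lt_of_le_of_ne hj.1.1 (Ne.symm hnx), lt_of_le_of_ne hj.1.2 hny⟩

/-- The complement consists of the open interiors of the classes, where the extreme classes also
keep their outer ends. -/
theorem isClosed_skeleton (hK : ¬ JumpNear (⊥ : K) ⊤) : IsClosed (skeleton K) := by
  rw [← isOpen_compl_iff, isOpen_iff_mem_nhds]
  intro x hx
  have hx : ¬ ((nearMin x = x ∧ ¬ JumpNear ⊥ x) ∨ (nearMax x = x ∧ ¬ JumpNear x ⊤)) := hx
  rw [not_or, not_and_not_right, not_and_not_right] at hx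
  by_cases hb : JumpNear ⊥ x
  · have ht : ¬ JumpNear x ⊤ := fun h => hK (hb.trans h)
    have hlt : x < nearMax x := lt_of_le_of_ne (le_nearMax x) fun h => ht (hx.2 h.symm)
    filter_upwards [Iio_mem_nhds hlt] with y hy
    have hby : JumpNear ⊥ y :=
      (hb.trans (jumpNear_nearMax x)).left_of_le_of_le bot_le (le_of_lt hy)
    rintro (⟨-, h⟩ | ⟨h, -⟩)
    · exact h hby
    · rw [JumpNear.nearMax_eq (hb.symm.trans hby), h] at hy
      exact lt_irrefl _ hy
  by_cases ht : JumpNear x ⊤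
  · have hlt : nearMin x < x := lt_of_le_of_ne (nearMin_le x) fun h => hb (hx.1 h)
    filter_upwards [Ioi_mem_nhds hlt] with y hy
    have hty : JumpNear y ⊤ :=
      ((jumpNear_nearMin x).symm.trans ht).right_of_le_of_le (le_of_lt hy) le_top
    rintro (⟨h, -⟩ | ⟨-, h⟩)
    · rw [JumpNear.nearMin_eq (ht.trans hty.symm), h] at hy
      exact lt_irrefl _ hy
    · exact h hty
  have hlt : x < nearMax x := lt_of_le_of_ne (le_nearMax x) fun h => ht (hx.2 h.symm)
  have hlt' : nearMin x < x := lt_of_le_of_ne (nearMin_le x) fun h => hb (hx.1 h)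
  filter_upwards [Ioo_mem_nhds hlt' hlt] with y hy
  have hxy : JumpNear x y := jumpNear_of_mem_Icc ⟨hy.1.le, hy.2.le⟩
  rw [hxy.nearMin_eq, hxy.nearMax_eq] at hy
  rintro (⟨h, -⟩ | ⟨h, -⟩)
  · exact hy.1.ne h
  · exact hy.2.ne h.symm

theorem nearMax_le_of_lt_of_mem_skeleton {b : K} (hx : x ∈ skeleton K) (hb : b ∈ classMins K)
    (hbx : b < x) : nearMax b ≤ x := by
  by_contra! h
  have hnear : JumpNear b x := (jumpNear_nearMax b).left_of_le_of_le hbx.le h.le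
  rcases hx with ⟨h1, -⟩ | ⟨h1, -⟩
  · rw [← hnear.nearMin_eq, hb.1] at h1
    exact hbx.ne h1
  · rw [← hnear.nearMax_eq] at h1
    exact h.ne h1.symm

/-- Near points of the skeleton are the two ends of one class, so the lower one serves; otherwise
there are even uncountably many class minima in between. -/
theorem exists_classMins_between (hx : x ∈ skeleton K) (hy : y ∈ skeleton K) (hxy : x < y) :
    ∃ b ∈ classMins K, x ≤ b ∧ b < y := by
  by_cases h : JumpNear x y
  · have h1 : nearMin x = x ∧ ¬ JumpNear ⊥ x := hx.resolve_right fun h1 =>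
      (JumpNear.le_nearMax h).not_gt (h1.1.symm ▸ hxy)
    have h2 : nearMax y = y ∧ ¬ JumpNear y ⊤ := hy.resolve_left fun h2 =>
      (JumpNear.nearMin_le h.symm).not_gt (h2.1.symm ▸ hxy)
    exact ⟨x, ⟨h1.1, hxy.trans_le (JumpNear.le_nearMax h), h1.2, fun ht => h2.2 (h.symm.trans ht)⟩,
      le_rfl, hxy⟩
  · by_contra! hno
    refine not_countable_classMins_inter_Ioo hxy h (countable_empty.mono fun b hb => ?_)
    exact (hno b hb.1 hb.2.1.le).not_gt hb.2.2

open Classical in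
/-- The skeleton is homeomorphic to the space of cuts of the nontrivial classes. -/
theorem nonempty_skeleton_homeomorph (hK : ¬ JumpNear (⊥ : K) ⊤) :
    Nonempty (skeleton K ≃ₜ Cuts (classMins K)) := by
  have : CompactSpace (skeleton K) := isCompact_iff_compactSpace.1 (isClosed_skeleton hK).isCompact
  -- For `x` in the skeleton, `b < x` is equivalent to `nearMax b ≤ x`; hence it is a clopen
  -- condition.
  let Φ : skeleton K → Cuts (classMins K) := fun x => ⟨fun b => decide ((b : K) < x), by
    rw [antitone_bool_iff]
    intro b c hbc hc
    simp only [decide_eq_true_eq] at *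
    exact lt_of_le_of_lt hbc hc⟩
  have hcont : Continuous Φ := by
    refine (continuous_pi fun b => continuous_iff_continuousAt.2 fun x =>
      tendsto_nhds_of_eventually_eq ?_).subtype_mk _
    by_cases h : (b : K) < x
    · filter_upwards [continuous_subtype_val.continuousAt.eventually (lt_mem_nhds h)] with x' hx'
      simp [h, hx']
    · have hlt : (x : K) < nearMax (b : K) := lt_of_le_of_lt (not_lt.1 h) b.2.2.1
      filter_upwards [continuous_subtype_val.continuousAt.eventually (gt_mem_nhds hlt)] with x' hx'
      have : ¬ (b : K) < x' := fun h' =>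
        (nearMax_le_of_lt_of_mem_skeleton x'.2 b.2 h').not_gt hx'
      simp only [h, this]
  have hinj : ∀ x y : skeleton K, (x : K) < y → Φ x ≠ Φ y := fun x y hxy h => by
    obtain ⟨b, hb, hxb, hby⟩ := exists_classMins_between x.2 y.2 hxy
    have := congrFun (congrArg Subtype.val h) ⟨b, hb⟩
    simp [Φ, hby, hxb.not_gt] at this
  have hbij : Function.Bijective Φ := by
    constructor
    · intro x y hxy
      by_contra hne
      rcases lt_or_gt_of_ne hne with h | h
      · exact hinj x y h hxy
      · exact hinj y x h hxy.symm
    · intro s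
      -- The preimage of `s` is the supremum of the class maxima over `s`; the point `nearMax ⊥`
      -- takes care of the empty cut.
      let S : Set K := insert (nearMax ⊥) ((fun b : classMins K => nearMax (b : K)) '' {b | s.1 b})
      have hS : S ⊆ skeleton K := by
        rintro _ (rfl | ⟨b, -, rfl⟩)
        · exact Or.inr ⟨(jumpNear_nearMax _).nearMax_eq.symm,
            fun h => hK ((jumpNear_nearMax _).trans h)⟩
        · exact Or.inr ⟨(jumpNear_nearMax _).nearMax_eq.symm,
            fun h => b.2.2.2.2 ((jumpNear_nearMax _).trans h)⟩
      obtain ⟨t, ht, hmax⟩ := (isClosed_closure (s := S)).isCompact.exists_isGreatest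
        ⟨_, subset_closure (mem_insert _ _)⟩
      refine ⟨⟨t, closure_minimal hS (isClosed_skeleton hK) ht⟩, Subtype.ext (funext fun b => ?_)⟩
      rw [Bool.eq_iff_iff]
      simp only [Φ, decide_eq_true_eq]
      constructor
      · intro hbt
        by_contra hsb
        refine (closure_minimal (t := Iic (b : K)) ?_ isClosed_Iic ht : t ≤ b).not_gt hbt
        rintro _ (rfl | ⟨c, hc, rfl⟩)
        · refine le_of_not_gt fun h => b.2.2.2.1 ?_
          exact (jumpNear_nearMax ⊥).left_of_le_of_le bot_le h.le
        · have hcb : c < b := lt_of_not_ge fun h => hsb (antitone_bool_iff.1 s.2 _ _ h hc)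
          refine le_of_not_gt fun h => ?_
          exact not_jumpNear_of_mem_classMins c.2 b.2 (Subtype.coe_injective.ne hcb.ne)
            ((jumpNear_nearMax (c : K)).left_of_le_of_le hcb.le (le_of_lt h))
      · intro hsb
        exact b.2.2.1.trans_le (hmax (subset_closure (mem_insert_of_mem _ ⟨b, hsb, rfl⟩)))
  exact ⟨Continuous.homeoOfEquivCompactToT2 (f := Equiv.ofBijective Φ hbij) hcont⟩

/-- A map to the unit interval that separates the points outside the skeleton from all others. -/
theorem exists_separating_skeleton :
    ∃ q : C(K, unitInterval), ∀ x y, q x = q y → x = y ∨ x ∈ skeleton K ∧ y ∈ skeleton K := by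
  obtain ⟨D, hDc, hD⟩ := TopologicalSpace.exists_countable_dense K
  let E : Set K := ⋃ d ∈ D ∪ {⊥, ⊤}, {y | JumpNear d y}
  have hE : ∀ {x y : K}, JumpNear x y → x ∈ E → y ∈ E := fun {x y} hxy hx => by
    obtain ⟨d, hd, hdx⟩ := mem_iUnion₂.1 hx
    exact mem_biUnion hd (hdx.trans hxy)
  have hDE : D ⊆ E := fun d hd => mem_biUnion (Or.inl hd) (Near.refl d)
  have hEJ : (E ∩ jumps K).Countable := by
    simp only [E, iUnion_inter]
    exact (hDc.union (Set.toFinite _).countable).biUnion fun d _ => countable_near_inter_jumps d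
  -- `E` collects the countably many classes that meet `D ∪ {⊥, ⊤}`, so it contains countably many
  -- jumps. Separating these and the pairs from `D` suffices to separate each point of `E` from
  -- every other point.
  let T : Set (K × K) := {p | p.1 ∈ D ∧ p.2 ∈ D ∧ p.1 < p.2} ∪ {p | p.1 ∈ E ∧ p.1 ⋖ p.2}
  have hT : T.Countable := by
    refine Set.Countable.union (Set.Countable.mono ?_ (hDc.prod hDc)) ?_
    · exact fun p hp => ⟨hp.1, hp.2.1⟩
    refine (hEJ.biUnion fun j _ =>
      ((subsingleton_setOf_covBy j).image (Prod.mk j)).countable).mono fun p hp => ?_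
    exact mem_biUnion (⟨hp.1, p.2, hp.2⟩ : p.1 ∈ E ∩ jumps K) ⟨p.2, hp.2, rfl⟩
  obtain ⟨q, hq, hqT⟩ := exists_monotone_continuous_lt_of_countable hT fun p hp => by
    rcases hp with hp | hp
    · exact hp.2.2
    · exact hp.2.lt
  have hcov : ∀ {x y : K}, x < y → ¬ (Ioo x y).Nonempty → x ⋖ y := fun h hne =>
    ⟨h, fun z h1 h2 => hne ⟨z, h1, h2⟩⟩
  have hqE : ∀ {x y : K}, x ∈ E → x ⋖ y → q x < q y := fun {x y} hx h =>
    hqT (x, y) (Or.inr ⟨hx, h⟩)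
  have hqD : ∀ {x y : K}, x ∈ D → y ∈ D → x < y → q x < q y := fun {x y} hx hy h =>
    hqT (x, y) (Or.inl ⟨hx, hy, h⟩)
  have hleft : ∀ {x y : K}, x ∈ E → x < y → q x < q y := fun {x y} hx hxy => by
    by_cases hne : (Ioo x y).Nonempty
    · obtain ⟨d, hd, hxd, hdy⟩ := exists_mem_Ioo_of_dense hD hne
      refine lt_of_lt_of_le ?_ (hq hdy.le)
      by_cases hne' : (Ioo x d).Nonempty
      · obtain ⟨d', hd', hxd', hdd'⟩ := exists_mem_Ioo_of_dense hD hne'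
        exact lt_of_le_of_lt (hq hxd'.le) (hqD hd' hd hdd')
      · exact hqE hx (hcov hxd hne')
    · exact hqE hx (hcov hxy hne)
  have hright : ∀ {x y : K}, y ∈ E → x < y → q x < q y := fun {x y} hy hxy => by
    by_cases hne : (Ioo x y).Nonempty
    · obtain ⟨d, hd, hxd, hdy⟩ := exists_mem_Ioo_of_dense hD hne
      exact lt_of_le_of_lt (hq hxd.le) (hleft (hDE hd) hdy)
    · have h := hcov hxy hne
      exact hqE (hE (Near.of_covBy h).symm hy) h
  -- A class outside `E` has no interior, since that would contain a dense point; so it consists of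
  -- its endpoints.
  have hskel : ∀ {x : K}, x ∉ E → x ∈ skeleton K := fun {x} hx => by
    have hb : ¬ JumpNear ⊥ x := fun h => hx (mem_biUnion (Or.inr (Or.inl rfl)) h)
    have ht : ¬ JumpNear x ⊤ := fun h => hx (mem_biUnion (Or.inr (Or.inr rfl)) h.symm)
    by_contra hsk
    have h1 : nearMin x < x := lt_of_le_of_ne (nearMin_le x) fun h => hsk (Or.inl ⟨h, hb⟩)
    have h2 : x < nearMax x := lt_of_le_of_ne (le_nearMax x) fun h => hsk (Or.inr ⟨h.symm, ht⟩)
    obtain ⟨d, hd, hd1, hd2⟩ := exists_mem_Ioo_of_dense hD ⟨x, h1, h2⟩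
    exact hx (mem_biUnion (Or.inl hd) (jumpNear_of_mem_Icc ⟨hd1.le, hd2.le⟩).symm)
  have key : ∀ x y : K, x < y → q x = q y → x ∈ skeleton K ∧ y ∈ skeleton K := fun x y hxy h =>
    ⟨hskel fun hx => (hleft hx hxy).ne h, hskel fun hy => (hright hy hxy).ne h⟩
  refine ⟨q, fun x y h => ?_⟩
  rcases lt_trichotomy x y with hxy | hxy | hxy
  · exact Or.inr (key x y hxy h)
  · exact Or.inl hxy
  · exact Or.inr (key y x hxy h.symm).symm

end Skeleton

/-! ### Real coordinates for the classes. -/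

section Coordinates

variable {K : Type*} [LinearOrder K] [TopologicalSpace K] [OrderTopology K] [CompactSpace K]
  [TopologicalSpace.SeparableSpace K] [BoundedOrder K]

/-- The nontrivial classes of near points of a separable compact line with `ℵ₁` jumps are ordered
like an `ℵ₁`-dense set of reals. -/
theorem exists_strictMono_classMins (hK : ¬ JumpNear (⊥ : K) ⊤) (hJ : #(jumps K) ≤ ℵ_ 1) :
    ∃ β : classMins K → ℝ, StrictMono β ∧ IsCardinalDense (ℵ_ 1) (range β) := by
  obtain ⟨D, hDc, hD⟩ := TopologicalSpace.exists_countable_dense K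
  -- Distinct classes have a class of a dense point strictly between them, so the minima of these
  -- classes, trivial ones included, form a countable dense order without endpoints, a copy of `ℚ`.
  let Q : Set K := {x | x ∈ nearMin '' D ∧ ¬ JumpNear ⊥ x ∧ ¬ JumpNear x ⊤}
  have hQc : Q.Countable := (hDc.image nearMin).mono fun x hx => hx.1
  have hQmin : ∀ a ∈ Q, nearMin a = a := by
    rintro _ ⟨⟨d, -, rfl⟩, -⟩
    exact (JumpNear.nearMin_eq (jumpNear_nearMin d)).symm
  have hfar : ∀ {a b : K}, nearMin a = a → nearMin b = b → a ≠ b → ¬ JumpNear a b :=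
    fun ha hb hne h => hne (by rw [← ha, ← hb, JumpNear.nearMin_eq h])
  have hbtw : ∀ {x y : K}, x < y → ¬ JumpNear x y →
      ∃ a ∈ Q, x < a ∧ a < y ∧ ¬ JumpNear x a ∧ ¬ JumpNear a y := by
    intro x y hxy h
    obtain ⟨d, hd, h1, h2, h3, h4⟩ := exists_between_of_not_jumpNear hD hxy h
    have hn := jumpNear_nearMin d
    have hxd : x < nearMin d := lt_of_not_ge fun hle =>
      h3 (hn.symm.right_of_le_of_le hle h1.le)
    refine ⟨nearMin d, ⟨⟨d, hd, rfl⟩, fun hb => ?_, fun ht => ?_⟩, hxd,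
      (nearMin_le d).trans_lt h2, fun hx => h3 (hx.trans hn.symm), fun hy => h4 (hn.trans hy)⟩
    · exact h3 ((hb.trans hn.symm).right_of_le_of_le bot_le h1.le)
    · exact h4 ((hn.trans ht).left_of_le_of_le h2.le le_top)
  have hbot : ∀ {x : K}, ¬ JumpNear ⊥ x → ⊥ < x := fun {x} h =>
    bot_lt_iff_ne_bot.2 fun hx => h (hx ▸ Near.refl _)
  have htop : ∀ {x : K}, ¬ JumpNear x ⊤ → x < ⊤ := fun {x} h =>
    lt_top_iff_ne_top.2 fun hx => h (hx ▸ Near.refl _)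
  have : Countable Q := hQc.to_subtype
  have : Nonempty Q := by
    obtain ⟨a, ha, -⟩ := hbtw (hbot hK) hK
    exact ⟨⟨a, ha⟩⟩
  have : DenselyOrdered Q := ⟨fun a b hab => by
    obtain ⟨c, hc, h1, h2, -⟩ := hbtw hab
      (hfar (hQmin a a.2) (hQmin b b.2) (Subtype.coe_injective.ne hab.ne))
    exact ⟨⟨c, hc⟩, h1, h2⟩⟩
  have : NoMaxOrder Q := ⟨fun a => by
    obtain ⟨c, hc, h1, -⟩ := hbtw (htop a.2.2.2) a.2.2.2
    exact ⟨⟨c, hc⟩, h1⟩⟩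
  have : NoMinOrder Q := ⟨fun a => by
    obtain ⟨c, hc, -, h2, -⟩ := hbtw (hbot a.2.2.1) a.2.2.1
    exact ⟨⟨c, hc⟩, h2⟩⟩
  obtain ⟨e⟩ := Order.iso_of_countable_dense Q ℚ
  have he : ∀ {a b : Q}, (a : K) < b → (e a : ℝ) < e b := fun {a b} h => by
    exact_mod_cast e.strictMono (show a < b from h)
  let V : K → Set ℝ := fun x => (fun a : Q => (e a : ℝ)) '' {a | (a : K) < x ∧ ¬ JumpNear (a : K) x}
  -- The real number cut out in `ℚ` by the points of `Q` below `x`. It is strictly monotone because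
  -- two points of `Q` fit between any two class minima.
  let β : classMins K → ℝ := fun x => sSup (V x)
  have hbdd : ∀ x : classMins K, ∀ b : Q, (x : K) < b → (e b : ℝ) ∈ upperBounds (V x) := by
    rintro x b hb _ ⟨a, ha, rfl⟩
    exact (he (ha.1.trans hb)).le
  have hV : ∀ x : classMins K, (V x).Nonempty ∧ BddAbove (V x) := fun x => by
    obtain ⟨a, ha, -, h2, -, h4⟩ := hbtw (hbot x.2.2.2.1) x.2.2.2.1
    obtain ⟨b, hb, h1, -⟩ := hbtw (htop x.2.2.2.2) x.2.2.2.2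
    exact ⟨⟨_, ⟨a, ha⟩, ⟨h2, h4⟩, rfl⟩, _, hbdd x ⟨b, hb⟩ h1⟩
  have hβle : ∀ (x : classMins K) (b : Q), (x : K) < b → β x ≤ e b := fun x b hb =>
    csSup_le (hV x).1 (hbdd x b hb)
  have hleβ : ∀ (x : classMins K) (a : Q), (a : K) < x → ¬ JumpNear (a : K) x → (e a : ℝ) ≤ β x :=
    fun x a h1 h2 => le_csSup (hV x).2 ⟨a, ⟨h1, h2⟩, rfl⟩
  have hβ : StrictMono β := fun x y hxy => by
    obtain ⟨a, ha, h1, h2, -, h4⟩ := hbtw (show (x : K) < y from hxy)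
      (not_jumpNear_of_mem_classMins x.2 y.2 (Subtype.coe_injective.ne hxy.ne))
    obtain ⟨b, hb, h5, h6, -, h8⟩ := hbtw h2 h4
    exact (hβle x ⟨a, ha⟩ h1).trans_lt ((he (a := ⟨a, ha⟩) (b := ⟨b, hb⟩) h5).trans_le
      (hleβ y ⟨b, hb⟩ h6 h8))
  refine ⟨β, hβ, isCardinalDense_aleph_one_iff.2 ⟨?_, fun p q hpq hc => ?_⟩⟩
  · have := Cardinal.mk_range_le_lift (f := β)
    have h2 := Cardinal.lift_le_aleph_one.2 (mk_classMins_le hJ)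
    exact Cardinal.lift_le_aleph_one.1 (this.trans h2)
  · obtain ⟨r, hpr, hrq⟩ := exists_rat_btwn hpq
    obtain ⟨s, hrs, hsq⟩ := exists_rat_btwn hrq
    have hrs' : r < s := by exact_mod_cast hrs
    let a := e.symm r
    let b := e.symm s
    have hab : (a : K) < b := e.symm.strictMono hrs'
    -- The points of `Q` coded by `r < s` are not near, so uncountably many class minima lie between
    -- them, and `β` sends these into `[r, s]`.
    refine not_countable_classMins_inter_Ioo hab
      (hfar (hQmin a a.2) (hQmin b b.2) hab.ne) ?_
    have h1 : (β ⁻¹' (range β ∩ Ioo p q)).Countable := hc.preimage hβ.injective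
    refine (h1.image Subtype.val).mono fun x hx => ?_
    let x' : classMins K := ⟨x, hx.1⟩
    refine ⟨x', ⟨⟨x', rfl⟩, ?_, ?_⟩, rfl⟩
    · refine hpr.trans_le ?_
      have := hleβ x' a hx.2.1 (hfar (hQmin a a.2) hx.1.1 hx.2.1.ne)
      simpa [a] using this
    · refine lt_of_le_of_lt ?_ hsq
      have := hβle x' b hx.2.2
      simpa [b] using this

end Coordinates

/-! ### Assembly of the decomposition. -/

theorem BaumgartnerAxiom.nonempty_continuousMap_equiv_prod (hBA : BaumgartnerAxiom (ℵ_ 1))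
    {K : Type*} [LinearOrder K] [TopologicalSpace K] [OrderTopology K] [CompactSpace K]
    [TopologicalSpace.SeparableSpace K] [BoundedOrder K] (hK : topologicalWeight K = ℵ_ 1) :
    Nonempty (C(K, ℝ) ≃L[ℝ] (C(K, ℝ) × C(K, ℝ))) := by
  have hJ : ¬ JumpNear (⊥ : K) ⊤ := fun h => not_countable_jumps hK.ge (by simpa using h.1)
  have hL := isClosed_skeleton hJ
  have : CompactSpace (skeleton K) := isCompact_iff_compactSpace.1 hL.isCompact
  obtain ⟨B, hB, ⟨e₁⟩, hZ⟩ := hBA.exists_absorbing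
  obtain ⟨β, hβ, hd⟩ := exists_strictMono_classMins hJ (mk_jumps_le_topologicalWeight.trans hK.le)
  obtain ⟨i⟩ := hBA.nonempty_orderIso hβ hd hB
  obtain ⟨h⟩ := nonempty_skeleton_homeomorph hJ
  obtain ⟨q, hq⟩ := exists_separating_skeleton (K := K)
  obtain ⟨j, r, hr⟩ := exists_ker_restrict_retract hL q hq
  obtain ⟨e₂⟩ := hZ (restrictCLM (skeleton K)).ker j r hr
  obtain ⟨E, hE⟩ := exists_extension_operator hL
  let e₃ : C(K, ℝ) ≃L[ℝ] C(skeleton K, ℝ) × (restrictCLM (skeleton K)).ker :=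
    ContinuousLinearEquiv.equivOfRightInverse (restrictCLM (skeleton K)) E
      fun f => ContinuousMap.ext fun x => hE f x
  let e₄ : C(Cuts B, ℝ) ≃L[ℝ] C(skeleton K, ℝ) :=
    (h.trans (Cuts.homeomorph i).symm).continuousMapCLE
  -- `C(K) ≅ C(skeleton K) ⊕ Z ≅ C(Cuts B) ⊕ Z ≅ C(Cuts B)`, with `Z` the kernel of restriction to
  -- the skeleton.
  let e₅ : C(K, ℝ) ≃L[ℝ] C(Cuts B, ℝ) :=
    (e₃.trans (e₄.symm.prodCongr (.refl ℝ _))).trans e₂.symm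
  exact ⟨(e₅.trans e₁).trans (e₅.symm.prodCongr e₅.symm)⟩

theorem corollary1p4 (hBA : BaumgartnerAxiom (ℵ_ 1))
    (K : Type*) [LinearOrder K] [TopologicalSpace K] [OrderTopology K] [CompactSpace K]
    [TopologicalSpace.SeparableSpace K] (hK : topologicalWeight K = ℵ_ 1) :
    Nonempty (C(K, ℝ) ≃L[ℝ] (C(K, ℝ) × C(K, ℝ))) := by
  have hne : (univ : Set K).Nonempty := by
    by_contra hne
    rw [not_nonempty_iff_eq_empty] at hne
    exact not_countable_jumps hK.ge (countable_empty.mono (hne ▸ subset_univ _))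
  obtain ⟨a, -, ha⟩ := isCompact_univ.exists_isLeast hne
  obtain ⟨b, -, hb⟩ := isCompact_univ.exists_isGreatest hne
  let _ : BoundedOrder K :=
    { top := b, le_top := fun x => hb (mem_univ x), bot := a, bot_le := fun x => ha (mem_univ x) }
  exact hBA.nonempty_continuousMap_equiv_prod hK
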